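/- Let $E$ be a real Banach lattice with positive cone $E_+$, and let $\mathcal L(E)$ be the space of bounded linear operators on $E$ with the operator norm. A *semigroup* on $E$ is a map $S:(0,\infty)\to\mathcal L(E)$ with $S(s+t)=S(t)S(s)$ for all $s,t>0$ and $\sup_{0<t\le 1}\|S(t)\|<\infty$; no continuity in $t$ is assumed. It is *positive* if $S(t)E_+\subseteq E_+$ for all $t>0$. A positive semigroup $S$ is *irreducible* if for every $0\ne f\in E_+$ and every nonzero positive functional $\varphi\in E'$ there is $t>0$ with $\langle\varphi,S(t)f\rangle>0$. The *growth bound* of $S$ is the infimum in $[-\infty,\infty)$ of all $\omega\in\mathbb R$ for which there is $M\ge 0$ with $\|S(t)\|\le Me^{\omega t}$ for all $t>0$. The *essential norm* of $R\in\mathcal L(E)$ is $\|R\|_{\mathrm{ess}}=\inf\{\|R-K\|: K\in\mathcal L(E)\text{ compact}\}$, and $S$ is *asymptotically compact* if $\|S(t)\|_{\mathrm{ess}}<1$ for some $t>0$. A vector $u\in E_+$ is a *quasi-interior point* if $v\wedge(nu)\to v$ in norm as $n\to\infty$ for every $v\in E_+$; a functional $\varphi\in E'$ is *strictly positive* if $\langle\varphi,f\rangle>0$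 for every $0\ne f\in E_+$. Write $\varphi\otimes u$ for the operator $f\mapsto\langle\varphi,f\rangle u$. **Theorem.** Let $S$ be a positive and irreducible semigroup on $E$ with growth bound $0$. If $S$ is asymptotically compact, then there exist a quasi-interior point $u\in E_+$ and a strictly positive functional $\varphi\in E'$ such that $S(t)\to\varphi\otimes u$ in operator norm as $t\to\infty$. In particular, $S$ is bounded, i.e. $\sup_{t>0}\|S(t)\|<\infty$. -/

import Mathlib

open Filter Topology

namespace PosSemigroup

section Operators

variable {E : Type*} [NormedAddCommGroup E] [NormedSpace ℝ E]

/-- A one-parameter operator semigroup `S : (0, ∞) → L(E)`: it satisfies the semigroup law and is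
locally bounded at `0`. No continuity in time is required. The family is indexed by `ℝ`, but only
the values `S t` with `t > 0` are constrained or used, here and in all definitions below. -/
structure IsOperatorSemigroup (S : ℝ → E →L[ℝ] E) : Prop where
  add_eq : ∀ s t : ℝ, 0 < s → 0 < t → S (s + t) = (S t).comp (S s)
  locally_bounded : ∃ C : ℝ, ∀ t : ℝ, 0 < t → t ≤ 1 → ‖S t‖ ≤ C

/-- The semigroup is bounded: `sup_{t > 0} ‖S t‖ < ∞`. -/
def IsBoundedSemigroup (S : ℝ → E →L[ℝ] E) : Prop :=
  ∃ C : ℝ, ∀ t : ℝ, 0 < t → ‖S t‖ ≤ C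

/-- The growth bound, the infimum in the extended reals of all real `w` such that
`‖S t‖ ≤ M * exp (w * t)` for some `M ≥ 0` and all `t > 0`. -/
noncomputable def growthBound (S : ℝ → E →L[ℝ] E) : EReal :=
  ⨅ w ∈ {w : ℝ | ∃ M : ℝ, 0 ≤ M ∧ ∀ t : ℝ, 0 < t → ‖S t‖ ≤ M * Real.exp (w * t)}, (w : EReal)

/-- The essential norm of `R`: the distance (in operator norm) to the compact linear operators. -/
noncomputable def essNorm (R : E →L[ℝ] E) : ℝ :=
  ⨅ K : {K : E →L[ℝ] E // IsCompactOperator K}, ‖R - K.1‖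

/-- Asymptotic compactness (quasi-compactness): some `S t`, `t > 0`, has essential norm `< 1`. -/
def IsAsymptoticallyCompact (S : ℝ → E →L[ℝ] E) : Prop :=
  ∃ t : ℝ, 0 < t ∧ essNorm (S t) < 1

end Operators

section Order

variable {E : Type*} [NormedAddCommGroup E] [NormedSpace ℝ E] [Lattice E]

/-- The functional `φ` is positive. -/
def IsPositiveFunctional (φ : StrongDual ℝ E) : Prop :=
  ∀ f : E, 0 ≤ f → 0 ≤ φ f

/-- The functional `φ` is strictly positive. -/
def IsStrictlyPositive (φ : StrongDual ℝ E) : Prop :=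
  ∀ f : E, 0 < f → 0 < φ f

/-- `u` is a quasi-interior point of the positive cone: `u ≥ 0`, and `v ⊓ n u → v` in norm for each
`v ≥ 0`. -/
def IsQuasiInterior (u : E) : Prop :=
  0 ≤ u ∧ ∀ v : E, 0 ≤ v → Tendsto (fun n : ℕ => v ⊓ (n : ℝ) • u) atTop (𝓝 v)

/-- Each `S t`, `t > 0`, is a positive operator. -/
def IsPositiveSemigroup (S : ℝ → E →L[ℝ] E) : Prop :=
  ∀ t : ℝ, 0 < t → ∀ f : E, 0 ≤ f → 0 ≤ S t f

/-- Irreducibility of a positive semigroup: for each `f > 0` and each positive nonzero functional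
`φ` there is a time `t > 0` with `⟨φ, S t f⟩ > 0`. -/
def IsIrreducible (S : ℝ → E →L[ℝ] E) : Prop :=
  ∀ f : E, 0 < f → ∀ φ : StrongDual ℝ E, IsPositiveFunctional φ → φ ≠ 0 →
    ∃ t : ℝ, 0 < t ∧ 0 < φ (S t f)

end Order

end PosSemigroup

set_option linter.unusedSectionVars false

namespace PosSemigroup

/-! ### Banach lattice estimates and the Hahn–Banach form of irreducibility. -/

section Lattice

variable {E : Type*} [NormedAddCommGroup E] [NormedSpace ℝ E] [Lattice E] [IsOrderedAddMonoid E]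
  [IsOrderedModule ℝ E] [HasSolidNorm E]

/-! Fix `a > 0` such that `T = S a` has essential norm `< 1`. Growth bound `0` makes the powers of
`T` subexponential but of norm at least `1`. If `T` had no positive approximate fixed vectors, the
Neumann series `∑ r ^ n • T ^ n` would stay bounded as `r → 1`, and its square would force `‖T ^ N‖
= O(1 / N)` (`exists_approx_fixed`). Quasi-compactness upgrades approximate fixed vectors to some `x
> 0` with `T x = x`.

Irreducibility enters through `IsIrreducible.sublinear_nonpos`, applied to three functionals: a
limit of normalized orbit norms gives power boundedness of `T`; `‖P y⁺‖` shows that `P` below kills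
no nonzero positive vector; the distance of `y` from being dominated by multiples of `e` shows that
a fixed `e > 0` is quasi-interior.

Without continuity in time, the asymptotics are captured by a strong limit `P` of the powers of `T`
along an idempotent ultrafilter; `P` is a positive projection commuting with `S`. Its range is a
sublattice on which `S` acts by injective lattice homomorphisms, and quasi-compactness bounds the
size of disjoint families in it. A maximal such family consists of atoms, which `S` permutes up to
positive factors. Since every time is divisible by `N!`, each atom is actually fixed
(`IsDisjointFamily.apply_eq_self`), hence quasi-interior, so there is only one and `P` has rank one.
Strong convergence to `P` follows from boundedness, and finite nets turn it into norm convergence.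
-/

lemma norm_le_norm_of_nonneg_of_le {a b : E} (ha : 0 ≤ a) (h : a ≤ b) : ‖a‖ ≤ ‖b‖ :=
  norm_le_norm_of_abs_le_abs (by rwa [abs_of_nonneg ha, abs_of_nonneg (ha.trans h)])

lemma norm_posPart_le (a : E) : ‖a⁺‖ ≤ ‖a‖ := by
  rw [← norm_abs_eq_norm a]
  exact norm_le_norm_of_nonneg_of_le (posPart_nonneg a)
    (by rw [← posPart_add_negPart]; exact le_add_of_nonneg_right (negPart_nonneg a))

lemma posPart_add_le (a b : E) : (a + b)⁺ ≤ a⁺ + b⁺ :=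
  sup_le (add_le_add (le_posPart a) (le_posPart b))
    (add_nonneg (posPart_nonneg a) (posPart_nonneg b))

lemma smul_inf_of_pos {c : ℝ} (hc : 0 < c) (a b : E) : c • (a ⊓ b) = c • a ⊓ c • b :=
  (OrderIso.smulRight (β := E) hc).map_inf a b

lemma smul_sup_of_pos {c : ℝ} (hc : 0 < c) (a b : E) : c • (a ⊔ b) = c • a ⊔ c • b :=
  (OrderIso.smulRight (β := E) hc).map_sup a b

lemma posPart_smul_of_pos {c : ℝ} (hc : 0 < c) (a : E) : (c • a)⁺ = c • a⁺ := by
  rw [posPart_def, posPart_def, smul_sup_of_pos hc, smul_zero]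

lemma map_le_map_of_nonneg {A : E →L[ℝ] E} (hA : ∀ f, 0 ≤ f → 0 ≤ A f) {a b : E} (h : a ≤ b) :
    A a ≤ A b := by
  have := hA (b - a) (sub_nonneg.2 h)
  rwa [map_sub, sub_nonneg] at this

lemma abs_map_le {A : E →L[ℝ] E} (hA : ∀ f, 0 ≤ f → 0 ≤ A f) (y : E) : |A y| ≤ A |y| :=
  abs_le'.2 ⟨map_le_map_of_nonneg hA (le_abs_self y), by
    rw [← map_neg]; exact map_le_map_of_nonneg hA (neg_le_abs y)⟩

lemma norm_map_le_norm_map_abs {A : E →L[ℝ] E} (hA : ∀ f, 0 ≤ f → 0 ≤ A f) (y : E) :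
    ‖A y‖ ≤ ‖A |y|‖ := by
  rw [← norm_abs_eq_norm (A y)]
  exact norm_le_norm_of_nonneg_of_le (abs_nonneg _) (abs_map_le hA y)

lemma pow_nonneg_of_nonneg {A : E →L[ℝ] E} (hA : ∀ f, 0 ≤ f → 0 ≤ A f) (n : ℕ) :
    ∀ f, 0 ≤ f → 0 ≤ (A ^ n) f := by
  induction n with
  | zero => intro f hf; simpa using hf
  | succ n ih => intro f hf; rw [pow_succ]; exact ih _ (hA f hf)

/-- A sublinear functional dominated by the norm of the positive part, and nonpositive along the
orbit of one positive vector of an irreducible semigroup, is nonpositive. -/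
lemma IsIrreducible.sublinear_nonpos {S : ℝ → E →L[ℝ] E} (hirr : IsIrreducible S) {x : E}
    (hx : 0 < x) {p : E → ℝ} (hadd : ∀ a b, p (a + b) ≤ p a + p b)
    (hsmul : ∀ c : ℝ, 0 < c → ∀ a, p (c • a) ≤ c * p a) {C : ℝ} (hle : ∀ a, p a ≤ C * ‖a⁺‖)
    (horb : ∀ t, 0 < t → p (S t x) ≤ 0) (y : E) : p y ≤ 0 := by
  by_contra! hy
  have hsmul' : ∀ c : ℝ, 0 < c → ∀ a, p (c • a) = c * p a := fun c hc a => by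
    refine le_antisymm (hsmul c hc a) ?_
    have h := hsmul c⁻¹ (inv_pos.2 hc) (c • a)
    rw [smul_smul, inv_mul_cancel₀ hc.ne', one_smul] at h
    calc c * p a ≤ c * (c⁻¹ * p (c • a)) := by gcongr
      _ = p (c • a) := by field_simp
  have hp0 : p 0 = 0 := by
    have := hsmul' 2 two_pos 0
    rw [smul_zero] at this; linarith
  have hy0 : y ≠ 0 := by rintro rfl; exact hy.ne' hp0
  -- Hahn–Banach extends `c • y ↦ c * p y` below `p`. Domination by `C * ‖a⁺‖` makes the extension
  -- both continuous and positive, so it contradicts irreducibility.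
  obtain ⟨g, hg, hgp⟩ := exists_extension_of_le_sublinear
    (LinearPMap.mkSpanSingleton y (p y) hy0) p hsmul' hadd (by
      rintro ⟨z, hz⟩
      obtain ⟨c, rfl⟩ := Submodule.mem_span_singleton.1 hz
      refine (LinearPMap.mkSpanSingleton'_apply y (p y) _ c hz).trans_le ?_
      rw [smul_eq_mul]
      change c * p y ≤ p (c • y)
      rcases lt_trichotomy c 0 with hc | rfl | hc
      · have h1 := hadd (c • y) ((-c) • y)
        rw [← add_smul, add_neg_cancel, zero_smul, hp0, hsmul' (-c) (by linarith)] at h1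
        linarith
      · simp [hp0]
      · exact (hsmul' c hc y).ge)
  have hgy : g y = p y := by
    have h := hg ⟨y, Submodule.mem_span_singleton_self y⟩
    exact h.trans (LinearPMap.mkSpanSingleton_apply ℝ ℝ hy0 (p y))
  have hC : 0 ≤ C := by
    by_contra! hC
    exact (hy.trans_le (hle y)).not_ge (mul_nonpos_of_nonpos_of_nonneg hC.le (norm_nonneg _))
  have hb : ∀ z, g z ≤ C * ‖z‖ := fun z =>
    (hgp z).trans ((hle z).trans (mul_le_mul_of_nonneg_left (norm_posPart_le z) hC))
  let φ : StrongDual ℝ E := g.mkContinuous C fun z => by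
    rw [Real.norm_eq_abs, abs_le']
    refine ⟨hb z, ?_⟩
    rw [← map_neg, ← norm_neg]; exact hb (-z)
  have hφp : IsPositiveFunctional φ := fun f hf => by
    have h := (hgp (-f)).trans (hle (-f))
    rw [posPart_eq_zero.2 (neg_nonpos.2 hf), norm_zero, mul_zero, map_neg] at h
    exact neg_nonpos.1 h
  have hφ0 : φ ≠ 0 := fun h => by
    have : φ y = 0 := by rw [h]; rfl
    exact hy.ne' (hgy.symm.trans this)
  obtain ⟨t, ht, hlt⟩ := hirr x hx φ hφp hφ0
  exact hlt.not_ge ((hgp _).trans (horb t ht))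

lemma opNorm_le_of_nonneg {A : E →L[ℝ] E} (hA : ∀ f, 0 ≤ f → 0 ≤ A f) {C : ℝ} (hC : 0 ≤ C)
    (h : ∀ f, 0 ≤ f → ‖A f‖ ≤ C * ‖f‖) : ‖A‖ ≤ C :=
  A.opNorm_le_bound hC fun y => (norm_map_le_norm_map_abs hA y).trans
    ((h _ (abs_nonneg y)).trans_eq (by rw [norm_abs_eq_norm]))

/-- In a normed lattice, an element comparable to all real multiples of `e > 0` is one of them. -/
lemma exists_eq_smul_of_forall_le_or_ge {e y : E} (he : 0 < e)
    (h : ∀ c : ℝ, y ≤ c • e ∨ c • e ≤ y) : ∃ c : ℝ, y = c • e := by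
  -- No `z` lies below all multiples of `e`: otherwise `e ≤ (n + 1)⁻¹ • (-z) → 0`. Hence the two
  -- closed sets of scalars below are nonempty, and connectedness of `ℝ` makes them meet.
  have key : ∀ z : E, ∃ c : ℝ, ¬ (z ≤ c • e) := by
    intro z
    by_contra! hz
    have h1 : ∀ n : ℕ, e ≤ ((n : ℝ) + 1)⁻¹ • (-z) := fun n => by
      have h2 := hz (-((n : ℝ) + 1))
      have hn : (0 : ℝ) < (n : ℝ) + 1 := by positivity
      have h3 : ((n : ℝ) + 1) • e ≤ -z := by
        rw [neg_smul] at h2; exact le_neg_of_le_neg h2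
      have h4 := smul_le_smul_of_nonneg_left h3 (inv_pos.2 hn).le
      rwa [smul_smul, inv_mul_cancel₀ hn.ne', one_smul] at h4
    have h5 : Tendsto (fun n : ℕ => ((n : ℝ) + 1)⁻¹ • (-z)) atTop (𝓝 ((0 : ℝ) • (-z))) := by
      refine Tendsto.smul_const ?_ _
      simpa [one_div] using tendsto_one_div_add_atTop_nhds_zero_nat (𝕜 := ℝ)
    rw [zero_smul] at h5
    exact he.not_ge (ge_of_tendsto' h5 h1)
  have hcont : Continuous fun c : ℝ => c • e := by fun_prop
  have hA : IsClosed {c : ℝ | y ≤ c • e} := isClosed_le continuous_const hcont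
  have hB : IsClosed {c : ℝ | c • e ≤ y} := isClosed_le hcont continuous_const
  have hpre := isPreconnected_closed_iff.1 (isPreconnected_univ (α := ℝ)) _ _ hA hB
    (fun c _ => h c)
  obtain ⟨a, ha⟩ := key y
  obtain ⟨b, hb⟩ := key (-y)
  obtain ⟨c, -, h1, h2⟩ := hpre
    ⟨-b, trivial, (h (-b)).resolve_right fun h' => hb (by
      rw [neg_smul] at h'; exact neg_le.1 h')⟩
    ⟨a, trivial, (h a).resolve_left ha⟩
  exact ⟨c, le_antisymm h1 h2⟩

end Lattice

/-! ### Finite nets from quasi-compactness, and limits along ultrafilters. -/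

section Nets

variable {E : Type*} [NormedAddCommGroup E] [NormedSpace ℝ E]

/-- The compact operators form an ideal. With `‖T - K‖ < 1`, this makes high powers of `T` compact
up to a small error. -/
lemma exists_isCompactOperator_add_pow {T K : E →L[ℝ] E} (hK : IsCompactOperator K) (n : ℕ) :
    ∃ L : E →L[ℝ] E, IsCompactOperator L ∧ T ^ n = L + (T - K) ^ n := by
  induction n with
  | zero => exact ⟨0, isCompactOperator_zero, by simp⟩
  | succ n ih =>
    obtain ⟨L, hL, h⟩ := ih
    refine ⟨L * T + (T - K) ^ n * K, ?_, ?_⟩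
    · exact (hL.comp_clm T).add (hK.clm_comp ((T - K) ^ n))
    · rw [pow_succ, h, pow_succ]; noncomm_ring

/-- If `T` has essential norm less than one, then powers of `T` map bounded sets arbitrarily close
to finite sets. -/
lemma exists_pow_net {T : E →L[ℝ] E} (hT : essNorm T < 1) {ε : ℝ} (hε : 0 < ε) (r : ℝ) :
    ∃ k : ℕ, 0 < k ∧ ∃ F : Set E, F.Finite ∧ ∀ y, ‖y‖ ≤ r → ∃ c ∈ F, ‖(T ^ k) y - c‖ < ε := by
  have : Nonempty {K : E →L[ℝ] E // IsCompactOperator K} := ⟨⟨0, isCompactOperator_zero⟩⟩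
  obtain ⟨⟨K, hK⟩, hlt⟩ := exists_lt_of_ciInf_lt hT
  have hlim : Tendsto (fun n : ℕ => ‖T - K‖ ^ n * |r|) atTop (𝓝 (0 * |r|)) :=
    (tendsto_pow_atTop_nhds_zero_of_lt_one (norm_nonneg _) hlt).mul_const _
  rw [zero_mul] at hlim
  obtain ⟨k, hk1, hk⟩ := ((eventually_ge_atTop 1).and
    (hlim.eventually (gt_mem_nhds (half_pos hε)))).exists
  obtain ⟨L, hL, hTL⟩ := exists_isCompactOperator_add_pow hK (T := T) k
  have htb : TotallyBounded (L '' Metric.closedBall 0 r) :=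
    (hL.isCompact_closure_image_closedBall r).totallyBounded.subset subset_closure
  obtain ⟨F, hF, hcov⟩ := Metric.totallyBounded_iff.1 htb (ε / 2) (half_pos hε)
  refine ⟨k, hk1, F, hF, fun y hy => ?_⟩
  have := hcov (Set.mem_image_of_mem L (mem_closedBall_zero_iff.2 hy))
  simp only [Set.mem_iUnion, Metric.mem_ball, dist_eq_norm] at this
  obtain ⟨c, hc, hlt'⟩ := this
  refine ⟨c, hc, ?_⟩
  have h1 : ‖((T - K) ^ k) y‖ ≤ ‖T - K‖ ^ k * |r| :=
    (((T - K) ^ k).le_opNorm y).trans (mul_le_mul (norm_pow_le' _ (by omega))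
      (hy.trans (le_abs_self r)) (norm_nonneg _) (by positivity))
  calc ‖(T ^ k) y - c‖ = ‖(L y - c) + ((T - K) ^ k) y‖ := by
        rw [hTL, add_apply]; congr 1; abel
    _ ≤ ‖L y - c‖ + ‖((T - K) ^ k) y‖ := norm_add_le _ _
    _ < ε := by linarith

/-- Along an ultrafilter, a function with values eventually close to finite sets converges. -/
lemma exists_tendsto_of_net {ι X : Type*} [PseudoMetricSpace X] [CompleteSpace X]
    (U : Ultrafilter ι) (f : ι → X)
    (h : ∀ ε > 0, ∃ F : Set X, F.Finite ∧ ∀ᶠ i in U, ∃ c ∈ F, dist (f i) c < ε) :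
    ∃ a, Tendsto f U (𝓝 a) := by
  refine cauchy_map_iff_exists_tendsto.1 (Metric.cauchy_iff.2 ⟨inferInstance, fun ε hε => ?_⟩)
  obtain ⟨F, hF, hev⟩ := h (ε / 2) (half_pos hε)
  have hmem : (⋃ c ∈ F, {i | dist (f i) c < ε / 2}) ∈ U := by
    filter_upwards [hev] with i hi
    simpa using hi
  obtain ⟨c, -, hc⟩ := (Ultrafilter.finite_biUnion_mem_iff hF).1 hmem
  refine ⟨f '' {i | dist (f i) c < ε / 2}, image_mem_map hc, ?_⟩
  rintro _ ⟨i, hi, rfl⟩ _ ⟨j, hj, rfl⟩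
  have := dist_triangle_right (f i) (f j) c
  simp only [Set.mem_ofPred_eq] at hi hj
  linarith

lemma exists_tendsto_of_bounded {ι : Type*} (U : Ultrafilter ι) (f : ι → ℝ) {a b : ℝ}
    (h : ∀ i, f i ∈ Set.Icc a b) : ∃ c, Tendsto f U (𝓝 c) := by
  obtain ⟨c, -, hc⟩ := (isCompact_Icc (a := a) (b := b)).ultrafilter_le_nhds (U.map f)
    (le_principal_iff.2 (Filter.mem_map.2 (Filter.univ_mem' h)))
  exact ⟨c, hc⟩

end Nets

/-! ### Semigroup algebra and the growth bound. -/

section Semigroup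

variable {E : Type*} [NormedAddCommGroup E] [NormedSpace ℝ E] {S : ℝ → E →L[ℝ] E}

lemma IsOperatorSemigroup.add_apply (hS : IsOperatorSemigroup S) {s t : ℝ} (hs : 0 < s)
    (ht : 0 < t) (y : E) : S (s + t) y = S s (S t y) := by
  rw [add_comm, hS.add_eq t s ht hs]; rfl

lemma IsOperatorSemigroup.apply_comm (hS : IsOperatorSemigroup S) {s t : ℝ} (hs : 0 < s)
    (ht : 0 < t) (y : E) : S s (S t y) = S t (S s y) := by
  rw [← hS.add_apply hs ht, add_comm, hS.add_apply ht hs]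

lemma IsOperatorSemigroup.add_nat_mul (hS : IsOperatorSemigroup S) {s t : ℝ} (hs : 0 < s)
    (ht : 0 < t) (n : ℕ) : S (s + n * t) = S s * S t ^ n := by
  induction n with
  | zero => simp
  | succ n ih =>
    have h : s + (n + 1 : ℕ) * t = t + (s + n * t) := by push_cast; ring
    rw [h, hS.add_eq _ _ ht (by positivity), ih, pow_succ]; rfl

lemma IsOperatorSemigroup.nat_mul (hS : IsOperatorSemigroup S) {t : ℝ} (ht : 0 < t) (n : ℕ) :
    S ((n + 1 : ℕ) * t) = S t ^ (n + 1) := by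
  have h : ((n + 1 : ℕ) : ℝ) * t = t + n * t := by push_cast; ring
  rw [h, hS.add_nat_mul ht ht, pow_succ']

lemma IsOperatorSemigroup.pow_apply_comm (hS : IsOperatorSemigroup S) {s t : ℝ} (hs : 0 < s)
    (ht : 0 < t) (n : ℕ) (y : E) : (S t ^ n) (S s y) = S s ((S t ^ n) y) := by
  have h : Commute (S t) (S s) := ContinuousLinearMap.ext fun z => hS.apply_comm ht hs z
  exact congrArg (fun A : E →L[ℝ] E => A y) (h.pow_left n).eq

lemma exists_eq_add_nat_mul {t a : ℝ} (ht : 0 < t) (ha : 0 < a) :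
    ∃ (n : ℕ) (s : ℝ), 0 < s ∧ s ≤ a ∧ t = s + n * a := by
  have h0 : 0 < ⌈t / a⌉₊ := Nat.ceil_pos.2 (div_pos ht ha)
  obtain ⟨n, hn⟩ := Nat.exists_eq_succ_of_ne_zero h0.ne'
  refine ⟨n, t - n * a, ?_, ?_, by ring⟩
  · have : n < ⌈t / a⌉₊ := by omega
    have := (lt_div_iff₀ ha).1 (Nat.lt_ceil.1 this)
    linarith
  · have h1 := Nat.le_ceil (t / a)
    rw [hn, div_le_iff₀ ha] at h1
    push_cast at h1
    linarith

lemma exists_exp_bound (h : growthBound S = 0) {w : ℝ} (hw : 0 < w) :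
    ∃ M : ℝ, 0 ≤ M ∧ ∀ t : ℝ, 0 < t → ‖S t‖ ≤ M * Real.exp (w * t) := by
  have hlt : growthBound S < (w : EReal) := by rw [h]; exact_mod_cast hw
  obtain ⟨v, hv⟩ := iInf_lt_iff.1 hlt
  obtain ⟨⟨M, hM, hb⟩, hvw⟩ := iInf_lt_iff.1 hv
  refine ⟨M, hM, fun t ht => (hb t ht).trans ?_⟩
  have : v ≤ w := (EReal.coe_lt_coe_iff.1 hvw).le
  gcongr

/-- If `‖S a‖ < 1`, then `S` decays geometrically along multiples of `a`, and the growth bound would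
be negative. -/
lemma one_le_norm_of_growthBound_eq_zero (hS : IsOperatorSemigroup S) (h : growthBound S = 0)
    {a : ℝ} (ha : 0 < a) : 1 ≤ ‖S a‖ := by
  by_contra! hlt
  obtain ⟨M, hM, hb⟩ := exists_exp_bound h one_pos
  obtain ⟨q, hq, hq1⟩ := exists_between (max_lt hlt zero_lt_one)
  have hq0 : 0 < q := (le_max_right _ _).trans_lt hq
  have hqa : ‖S a‖ ≤ q := (le_max_left _ _).trans hq.le
  have hw : Real.log q / a < 0 := div_neg_of_neg_of_pos (Real.log_neg hq0 hq1) ha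
  have hmem : Real.log q / a ∈ {w : ℝ | ∃ M : ℝ, 0 ≤ M ∧
      ∀ t : ℝ, 0 < t → ‖S t‖ ≤ M * Real.exp (w * t)} := by
    -- `M * exp a` bounds `S s` for `s ≤ a`; dividing by `q` pays for the incomplete last period.
    refine ⟨M * Real.exp a / q, by positivity, fun t ht => ?_⟩
    obtain ⟨n, s, hs, hsa, rfl⟩ := exists_eq_add_nat_mul ht ha
    have h1 : ‖S s‖ ≤ M * Real.exp a := (hb s hs).trans (by rw [one_mul]; gcongr)
    have h2 : q ^ (n + 1) ≤ Real.exp (Real.log q / a * (s + n * a)) := by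
      rw [← Real.exp_log (pow_pos hq0 _), Real.log_pow, Real.exp_le_exp]
      have : Real.log q / a * (s + n * a) = Real.log q * (s / a + n) := by field_simp
      rw [this, mul_comm]
      refine mul_le_mul_of_nonpos_left ?_ (Real.log_neg hq0 hq1).le
      have := (div_le_one ha).2 hsa
      push_cast; linarith
    rcases Nat.eq_zero_or_pos n with rfl | hn
    · have h3 : (1 : ℝ) ≤ Real.exp (Real.log q / a * (s + (0 : ℕ) * a)) / q := by
        rw [le_div_iff₀ hq0]; simpa using h2
      have h4 : S (s + (0 : ℕ) * a) = S s := by simp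
      rw [h4]
      calc ‖S s‖ ≤ M * Real.exp a * 1 := by rw [mul_one]; exact h1
        _ ≤ M * Real.exp a * (Real.exp (Real.log q / a * (s + (0 : ℕ) * a)) / q) := by gcongr
        _ = _ := by ring
    · rw [hS.add_nat_mul hs ha]
      calc ‖S s * S a ^ n‖ ≤ ‖S s‖ * ‖S a ^ n‖ := norm_mul_le _ _
        _ ≤ (M * Real.exp a) * q ^ n := by
          gcongr
          exact (norm_pow_le' _ hn).trans (by gcongr)
        _ = M * Real.exp a / q * q ^ (n + 1) := by rw [pow_succ]; field_simp
        _ ≤ _ := by gcongr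
  have hle : growthBound S ≤ ((Real.log q / a : ℝ) : EReal) := iInf₂_le _ hmem
  rw [h] at hle
  exact hw.not_ge (by exact_mod_cast hle)

end Semigroup

/-! ### A positive fixed vector and power boundedness. -/

section FixedVector

variable {E : Type*} [NormedAddCommGroup E] [NormedSpace ℝ E] [CompleteSpace E] [Lattice E]
  [IsOrderedAddMonoid E] [IsOrderedModule ℝ E] [HasSolidNorm E]

lemma summable_smul_pow {S : ℝ → E →L[ℝ] E} (hS : IsOperatorSemigroup S)
    (hgrowth : growthBound S = 0) {a : ℝ} (ha : 0 < a) {r : ℝ} (hr0 : 0 < r) (hr1 : r < 1) :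
    Summable fun n : ℕ => r ^ n • S a ^ n := by
  have hlog : Real.log r < 0 := Real.log_neg hr0 hr1
  -- This exponent spends half of the decay of `r ^ n`, leaving the ratio `exp (log r / 2) < 1`.
  obtain ⟨M, hM, hb⟩ := exists_exp_bound hgrowth (w := -Real.log r / (2 * a))
    (div_pos (neg_pos.2 hlog) (by positivity))
  have hq : Real.exp (Real.log r / 2) < 1 := by rw [Real.exp_lt_one_iff]; linarith
  rw [← summable_nat_add_iff 1]
  refine Summable.of_norm_bounded
    (g := fun n : ℕ => M * Real.exp (Real.log r / 2) ^ (n + 1)) ?_ fun n => ?_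
  · exact ((summable_nat_add_iff 1).2
      (summable_geometric_of_lt_one (Real.exp_pos _).le hq)).mul_left M
  · rw [norm_smul, ← hS.nat_mul ha, Real.norm_of_nonneg (by positivity)]
    calc r ^ (n + 1) * ‖S ((n + 1 : ℕ) * a)‖
        ≤ r ^ (n + 1) * (M * Real.exp (-Real.log r / (2 * a) * ((n + 1 : ℕ) * a))) := by
          gcongr; exact hb _ (by positivity)
      _ = M * Real.exp (Real.log r / 2) ^ (n + 1) := by
          rw [← Real.exp_nat_mul, ← Real.exp_log (pow_pos hr0 (n + 1)), Real.log_pow,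
            mul_left_comm, ← Real.exp_add]
          congr 2
          field_simp
          ring

/-- A positive operator whose powers grow subexponentially but do not tend to zero has positive
approximate fixed vectors. -/
lemma exists_approx_fixed {T : E →L[ℝ] E} (hT : ∀ f, 0 ≤ f → 0 ≤ T f)
    (hsum : ∀ r : ℝ, 0 < r → r < 1 → Summable fun n : ℕ => r ^ n • T ^ n)
    (hnorm : ∀ n : ℕ, 1 ≤ ‖T ^ (n + 1)‖) {ε : ℝ} (hε : 0 < ε) :
    ∃ x : E, 0 ≤ x ∧ ‖x‖ = 1 ∧ ‖x - T x‖ ≤ ε := by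
  by_contra! hcon
  have hlow : ∀ x, 0 ≤ x → ε * ‖x‖ ≤ ‖x - T x‖ := fun x hx => by
    rcases eq_or_ne x 0 with rfl | hx0
    · simp
    have hn : 0 < ‖x‖ := norm_pos_iff.2 hx0
    have h := (hcon (‖x‖⁻¹ • x) (smul_nonneg (by positivity) hx)
      (by rw [norm_smul, norm_inv, norm_norm, inv_mul_cancel₀ hn.ne'])).le
    rw [map_smul, ← smul_sub, norm_smul, norm_inv, norm_norm] at h
    calc ε * ‖x‖ ≤ (‖x‖⁻¹ * ‖x - T x‖) * ‖x‖ := by gcongr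
      _ = ‖x - T x‖ := by field_simp
  -- The right side does not depend on `r`. `G` is the inverse of `1 - r T`; the lower bound on the
  -- cone gives `‖G z‖ ≤ 2 / ε * ‖z‖` there, and `G ∘ G` contains the term `r ^ N • T ^ N` once for
  -- each of the `N + 1` splittings `N = k + (N - k)`.
  have key : ∀ r : ℝ, 0 < r → r < 1 → (1 - r) * ‖T‖ ≤ ε / 2 → ∀ (N : ℕ) (y : E), 0 ≤ y →
      (N + 1) * r ^ N * ‖(T ^ N) y‖ ≤ (2 / ε) ^ 2 * ‖y‖ := by
    intro r hr0 hr1 hr N y hy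
    obtain ⟨G, hG⟩ := hsum r hr0 hr1
    have happ : ∀ z, HasSum (fun n : ℕ => r ^ n • (T ^ n) z) (G z) := fun z =>
      ((ContinuousLinearMap.apply ℝ E z).hasSum hG :)
    have hterm : ∀ z, 0 ≤ z → ∀ n : ℕ, 0 ≤ r ^ n • (T ^ n) z := fun z hz n =>
      smul_nonneg (by positivity) (pow_nonneg_of_nonneg hT n z hz)
    have hpart : ∀ z, 0 ≤ z → ∀ s : Finset ℕ, ∑ n ∈ s, r ^ n • (T ^ n) z ≤ G z := fun z hz s =>
      sum_le_hasSum s (fun i _ => hterm z hz i) (happ z)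
    have hGnn : ∀ z, 0 ≤ z → 0 ≤ G z := fun z hz => by simpa using hpart z hz ∅
    have hid : ∀ z, G z - r • T (G z) = z := fun z => by
      have h1 := (hasSum_nat_add_iff' 1).2 (happ z)
      have h2 := (T.hasSum (happ z)).const_smul r
      have h3 := h1.unique (a₂ := r • T (G z)) (by
        convert h2 using 2 with n
        rw [map_smul, pow_succ', smul_smul, pow_succ' T]; rfl)
      simp only [Finset.range_one, Finset.sum_singleton, pow_zero, one_smul] at h3
      rw [← h3]; simp
    have hbd : ∀ z, 0 ≤ z → ‖G z‖ ≤ 2 / ε * ‖z‖ := fun z hz => by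
      have h1 : ε * ‖G z‖ ≤ ‖z‖ + ε / 2 * ‖G z‖ := by
        calc ε * ‖G z‖ ≤ ‖G z - T (G z)‖ := hlow _ (hGnn z hz)
          _ = ‖(G z - r • T (G z)) - (1 - r) • T (G z)‖ := by
            congr 1; rw [sub_smul, one_smul]; abel
          _ ≤ ‖G z - r • T (G z)‖ + ‖(1 - r) • T (G z)‖ := norm_sub_le _ _
          _ ≤ ‖z‖ + (1 - r) * (‖T‖ * ‖G z‖) := by
            rw [hid, norm_smul, Real.norm_of_nonneg (by linarith)]
            have : 0 ≤ 1 - r := by linarith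
            gcongr
            exact T.le_opNorm _
          _ ≤ ‖z‖ + ε / 2 * ‖G z‖ := by rw [← mul_assoc]; gcongr
      rw [div_mul_eq_mul_div, le_div_iff₀ hε]
      linarith
    have hle : ((N : ℝ) + 1) • (r ^ N • (T ^ N) y) ≤ G (G y) := by
      calc ((N : ℝ) + 1) • (r ^ N • (T ^ N) y)
          = ∑ k ∈ Finset.range (N + 1), r ^ N • (T ^ N) y := by
            rw [Finset.sum_const, Finset.card_range, ← Nat.cast_smul_eq_nsmul ℝ]; push_cast; rfl
        _ ≤ ∑ k ∈ Finset.range (N + 1), r ^ k • (T ^ k) (G y) := by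
            refine Finset.sum_le_sum fun k hk => ?_
            have hk' : k + (N - k) = N := by have := Finset.mem_range.1 hk; omega
            have h1 : r ^ (N - k) • (T ^ (N - k)) y ≤ G y := by
              simpa using hpart y hy {N - k}
            have h2 := map_le_map_of_nonneg (pow_nonneg_of_nonneg hT k) h1
            have h3 := smul_le_smul_of_nonneg_left h2 (pow_pos hr0 k).le
            refine le_of_eq_of_le ?_ h3
            rw [map_smul, smul_smul, ← pow_add, hk']
            have h4 : T ^ N = T ^ k * T ^ (N - k) := by rw [← pow_add, hk']
            rw [h4]; rfl
        _ ≤ G (G y) := hpart _ (hGnn y hy) _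
    have h0 : 0 ≤ ((N : ℝ) + 1) • (r ^ N • (T ^ N) y) :=
      smul_nonneg (by positivity) (hterm y hy N)
    have hn := norm_le_norm_of_nonneg_of_le h0 hle
    rw [norm_smul, norm_smul, Real.norm_of_nonneg (by positivity),
      Real.norm_of_nonneg (by positivity), ← mul_assoc] at hn
    calc _ ≤ ‖G (G y)‖ := hn
      _ ≤ 2 / ε * (2 / ε * ‖y‖) := (hbd _ (hGnn y hy)).trans (by gcongr; exact hbd y hy)
      _ = _ := by ring
  obtain ⟨N, hN⟩ := exists_nat_gt ((2 / ε) ^ 2)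
  have hlim : ‖T ^ (N + 1)‖ ≤ (2 / ε) ^ 2 / ((N + 1 : ℕ) + 1) := by
    refine opNorm_le_of_nonneg (pow_nonneg_of_nonneg hT _) (by positivity) fun y hy => ?_
    rw [div_mul_eq_mul_div, le_div_iff₀ (by positivity)]
    have hc : Tendsto (fun r : ℝ => ((N + 1 : ℕ) + 1) * r ^ (N + 1) * ‖(T ^ (N + 1)) y‖) (𝓝[<] 1)
        (𝓝 (((N + 1 : ℕ) + 1) * 1 ^ (N + 1) * ‖(T ^ (N + 1)) y‖)) :=
      Tendsto.mono_left (Continuous.tendsto (by fun_prop) 1) nhdsWithin_le_nhds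
    have hd : Tendsto (fun r : ℝ => (1 - r) * ‖T‖) (𝓝[<] 1) (𝓝 ((1 - 1) * ‖T‖)) :=
      Tendsto.mono_left (Continuous.tendsto (by fun_prop) 1) nhdsWithin_le_nhds
    rw [sub_self, zero_mul] at hd
    have := le_of_tendsto hc (b := (2 / ε) ^ 2 * ‖y‖) (by
      filter_upwards [self_mem_nhdsWithin, hd.eventually (gt_mem_nhds (half_pos hε)),
        mem_nhdsWithin_of_mem_nhds (lt_mem_nhds (zero_lt_one (α := ℝ)))] with r h1 h2 h3
      exact key r h3 h1 h2.le (N + 1) y hy)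
    rw [one_pow, mul_one] at this
    linarith
  have h1 := (hnorm N).trans hlim
  rw [le_div_iff₀ (by positivity)] at h1
  push_cast at h1
  linarith

/-- Approximate fixed vectors are asymptotically equal to their images under `T ^ k`, which lie near
a finite set; so they converge along an ultrafilter, and the limit keeps norm `1`. -/
lemma exists_fixed_of_approx {T : E →L[ℝ] E} (hess : essNorm T < 1)
    (happ : ∀ ε : ℝ, 0 < ε → ∃ x : E, 0 ≤ x ∧ ‖x‖ = 1 ∧ ‖x - T x‖ ≤ ε) :
    ∃ x : E, 0 < x ∧ T x = x := by
  choose x hx0 hx1 hxT using fun j : ℕ => happ (1 / ((j : ℝ) + 1)) (by positivity)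
  have hlim : Tendsto (fun j => T (x j) - x j) (hyperfilter ℕ) (𝓝 0) := by
    refine (squeeze_zero_norm (fun j => ?_) tendsto_one_div_add_atTop_nhds_zero_nat).mono_left
      Nat.hyperfilter_le_atTop
    rw [norm_sub_rev]; exact hxT j
  have hpow : ∀ k : ℕ, Tendsto (fun j => (T ^ k) (x j) - x j) (hyperfilter ℕ) (𝓝 0) := by
    intro k
    induction k with
    | zero => simp
    | succ k ih =>
      have h := ((T.continuous.tendsto 0).comp ih).add hlim
      rw [map_zero, add_zero] at h
      refine h.congr fun j => ?_
      rw [Function.comp_apply, map_sub, pow_succ']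
      simp
  obtain ⟨a, ha⟩ := exists_tendsto_of_net (hyperfilter ℕ) x fun ε hε => by
    obtain ⟨k, -, F, hF, hnet⟩ := exists_pow_net hess (half_pos hε) 1
    refine ⟨F, hF, ?_⟩
    have := (tendsto_zero_iff_norm_tendsto_zero.1 (hpow k)).eventually
      (gt_mem_nhds (half_pos hε))
    filter_upwards [this] with j hj
    obtain ⟨c, hc, hlt⟩ := hnet (x j) (hx1 j).le
    refine ⟨c, hc, ?_⟩
    have h1 := dist_triangle_left (x j) c ((T ^ k) (x j))
    rw [dist_eq_norm ((T ^ k) (x j)), dist_eq_norm ((T ^ k) (x j))] at h1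
    linarith
  have ha1 : ‖a‖ = 1 := tendsto_nhds_unique ha.norm (by simp [hx1])
  refine ⟨a, lt_of_le_of_ne (ge_of_tendsto' ha hx0) ?_, ?_⟩
  · rintro rfl
    simp at ha1
  · have h := ((T.continuous.tendsto a).comp ha).sub ha
    exact sub_eq_zero.1 (tendsto_nhds_unique h hlim)

/-- An irreducible positive semigroup is power bounded at each time where it is quasi-compact and
has a positive fixed vector. -/
lemma exists_norm_pow_le {S : ℝ → E →L[ℝ] E} (hS : IsOperatorSemigroup S)
    (hpos : IsPositiveSemigroup S) (hirr : IsIrreducible S) {a : ℝ} (ha : 0 < a)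
    (hess : essNorm (S a) < 1) {x : E} (hx : 0 < x) (hfix : S a x = x) :
    ∃ M : ℝ, ∀ n : ℕ, ‖S a ^ n‖ ≤ M := by
  by_contra! hunb
  set T := S a with hTdef
  have hTp : ∀ n : ℕ, ∀ f, 0 ≤ f → 0 ≤ (T ^ n) f := pow_nonneg_of_nonneg (hpos a ha)
  have hrec : ∀ j : ℕ, ∃ n : ℕ, (j : ℝ) < ‖T ^ n‖ ∧ ∀ m < n, ‖T ^ m‖ ≤ j := fun j => by
    classical
    exact ⟨Nat.find (hunb j), Nat.find_spec (hunb j), fun m hm => not_lt.1 (Nat.find_min _ hm)⟩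
  -- `n j` is the first exponent with `‖T ^ n‖ > j`, so `T ^ (n j - k) / ‖T ^ n j‖` is a
  -- contraction, also under truncated subtraction.
  choose n hn hmin using hrec
  obtain ⟨k, -, F, hF, hnet⟩ := exists_pow_net hess (half_pos one_pos) 1
  have hnpos : ∀ j, 0 < ‖T ^ n j‖ := fun j => (Nat.cast_nonneg j).trans_lt (hn j)
  have hmono : ∀ j, ‖T ^ (n j - k)‖ ≤ ‖T ^ n j‖ := fun j => by
    rcases (Nat.sub_le (n j) k).lt_or_eq with h | h
    · exact (hmin j _ h).trans (hn j).le
    · rw [h]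
  have hle : ∀ j y, ‖(T ^ (n j - k)) y‖ / ‖T ^ n j‖ ≤ ‖y‖ := fun j y => by
    rw [div_le_iff₀ (hnpos j), mul_comm]
    exact ((T ^ (n j - k)).le_opNorm y).trans (by gcongr; exact hmono j)
  choose p hp using fun y : E => exists_tendsto_of_bounded (hyperfilter ℕ)
    (fun j => ‖(T ^ (n j - k)) y⁺‖ / ‖T ^ n j‖) (a := 0) (b := ‖y⁺‖)
    fun j => ⟨by positivity, hle j _⟩
  have hp0 : ∀ y, p y ≤ 0 := by
    refine hirr.sublinear_nonpos hx (p := p) (C := 1) ?_ ?_ ?_ ?_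
    · intro y z
      refine le_of_tendsto_of_tendsto' (hp (y + z)) ((hp y).add (hp z)) fun j => ?_
      rw [← add_div]
      gcongr
      refine (norm_le_norm_of_nonneg_of_le (hTp _ _ (posPart_nonneg _))
        (map_le_map_of_nonneg (hTp _) (posPart_add_le y z))).trans ?_
      rw [map_add]; exact norm_add_le _ _
    · intro c hc y
      refine le_of_tendsto_of_tendsto' (hp (c • y)) ((hp y).const_mul c) fun j => ?_
      rw [posPart_smul_of_pos hc, map_smul, norm_smul, Real.norm_of_nonneg hc.le, mul_div_assoc]
    · intro y
      rw [one_mul]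
      exact le_of_tendsto' (hp y) fun j => hle j _
    -- `S t x` is again fixed by `T`, so its numerator is constant while `‖T ^ n j‖ > j`.
    · intro t ht
      have hz : Tendsto (fun j => ‖(T ^ (n j - k)) (S t x)⁺‖ / ‖T ^ n j‖) (hyperfilter ℕ)
          (𝓝 0) := by
        refine (squeeze_zero' (g := fun j : ℕ => ‖S t x‖ / j)
          (Eventually.of_forall fun j => by positivity) ?_
          (tendsto_const_div_atTop_nhds_zero_nat _)).mono_left Nat.hyperfilter_le_atTop
        filter_upwards [eventually_gt_atTop 0] with j hj
        have hfixn : ∀ m : ℕ, (T ^ m) x = x := fun m => by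
          induction m with
          | zero => rfl
          | succ m ih => rw [pow_succ]; change (T ^ m) (T x) = x; rw [hfix, ih]
        rw [posPart_of_nonneg (hpos t ht x hx.le), hS.pow_apply_comm ht ha, ← hTdef, hfixn]
        have := (hn j).le
        gcongr
      exact (tendsto_nhds_unique (hp _) hz).le
  have hsmall : ∀ᶠ j in hyperfilter ℕ, ∀ c ∈ F, ‖(T ^ (n j - k)) |c|‖ / ‖T ^ n j‖ < 1 / 4 := by
    refine (eventually_all_finite hF).2 fun c _ => ?_
    have h := hp |c|
    simp only [posPart_of_nonneg (abs_nonneg c)] at h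
    exact h.eventually (gt_mem_nhds ((hp0 _).trans_lt (by norm_num)))
  have hlarge : ∀ᶠ j : ℕ in hyperfilter ℕ, k ≤ n j := by
    refine Nat.hyperfilter_le_atTop ?_
    filter_upwards [eventually_ge_atTop ⌈∑ i ∈ Finset.range k, ‖T ^ i‖⌉₊] with j hj
    by_contra! hlt
    have h1 : ‖T ^ n j‖ ≤ ∑ i ∈ Finset.range k, ‖T ^ i‖ :=
      Finset.single_le_sum (f := fun i => ‖T ^ i‖) (fun _ _ => norm_nonneg _)
        (Finset.mem_range.2 hlt)
    have h2 := (Nat.ceil_le.1 hj)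
    linarith [hn j]
  obtain ⟨j, hj1, hj2⟩ := (hsmall.and hlarge).exists
  -- Split `T ^ k y` into a net point, contributing at most `1 / 4`, and an error of norm below `1 /
  -- 2`.
  have hfin : ‖T ^ n j‖ ≤ 3 / 4 * ‖T ^ n j‖ := by
    refine ContinuousLinearMap.opNorm_le_of_unit_norm (by positivity) fun y hy => ?_
    obtain ⟨c, hc, hlt⟩ := hnet y hy.le
    have h1 : (T ^ n j) y = (T ^ (n j - k)) ((T ^ k) y) := by
      conv_lhs => rw [← Nat.sub_add_cancel hj2, pow_add]
      rfl
    have h2 : ‖(T ^ (n j - k)) c‖ ≤ 1 / 4 * ‖T ^ n j‖ :=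
      (norm_map_le_norm_map_abs (hTp _) c).trans ((div_le_iff₀ (hnpos j)).1 (hj1 c hc).le)
    have h3 : ‖(T ^ (n j - k)) ((T ^ k) y - c)‖ ≤ ‖T ^ n j‖ * (1 / 2) :=
      ((T ^ (n j - k)).le_opNorm _).trans (by gcongr; exact hmono j)
    calc ‖(T ^ n j) y‖ = ‖(T ^ (n j - k)) c + (T ^ (n j - k)) ((T ^ k) y - c)‖ := by
          rw [h1, ← map_add]; congr 2; abel
      _ ≤ _ := (norm_add_le _ _).trans (by linarith)
  linarith [hnpos j]

lemma isBoundedSemigroup_of_norm_pow_le {S : ℝ → E →L[ℝ] E} (hS : IsOperatorSemigroup S)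
    (hgrowth : growthBound S = 0) {a : ℝ} (ha : 0 < a) {M : ℝ} (hM : ∀ n : ℕ, ‖S a ^ n‖ ≤ M) :
    IsBoundedSemigroup S := by
  obtain ⟨C, hC, hb⟩ := exists_exp_bound hgrowth one_pos
  have hM0 : 0 ≤ M := (norm_nonneg _).trans (hM 0)
  refine ⟨C * Real.exp a * M, fun t ht => ?_⟩
  obtain ⟨n, s, hs, hsa, rfl⟩ := exists_eq_add_nat_mul ht ha
  rw [hS.add_nat_mul hs ha]
  refine (norm_mul_le _ _).trans ?_
  gcongr
  · exact (hb s hs).trans (by rw [one_mul]; gcongr)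
  · exact hM n

end FixedVector

/-! ### The limit projection along an idempotent ultrafilter. -/

section Projection

lemma exists_idempotent_ultrafilter_nat : ∃ V : Ultrafilter ℕ, (V : Filter ℕ) ≤ atTop ∧
    ∀ p : ℕ → Prop, (∀ᶠ n in V, ∀ᶠ m in V, p (n + m)) → ∀ᶠ n in V, p n := by
  let _ : AddSemigroup (Ultrafilter ℕ+) := Ultrafilter.addSemigroup
  -- Ellis' lemma. Working in `ℕ+` excludes the principal idempotent at `0`, which is what forces
  -- convergence to infinity.
  obtain ⟨U, hU⟩ := exists_idempotent_of_compact_t2_of_continuous_add_left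
    (M := Ultrafilter ℕ+) Ultrafilter.continuous_add_left
  have hidem : ∀ p : ℕ → Prop, (∀ᶠ n in U.map ((↑) : ℕ+ → ℕ), ∀ᶠ m in U.map ((↑) : ℕ+ → ℕ),
      p (n + m)) → ∀ᶠ n in U.map ((↑) : ℕ+ → ℕ), p n := by
    intro p hp
    have h : ∀ᶠ n : ℕ+ in ((U + U : Ultrafilter ℕ+) : Filter ℕ+), p (n : ℕ) := by
      rw [Ultrafilter.eventually_add]
      simpa only [Ultrafilter.coe_map, eventually_map, PNat.add_coe] using hp
    rw [hU] at h
    simpa only [Ultrafilter.coe_map, eventually_map] using h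
  refine ⟨U.map ((↑) : ℕ+ → ℕ), ?_, hidem⟩
  have h1 : ∀ᶠ n in U.map ((↑) : ℕ+ → ℕ), 1 ≤ n := by
    simp only [Ultrafilter.coe_map, eventually_map]
    exact Eventually.of_forall fun n => n.pos
  refine tendsto_id'.1 (tendsto_atTop.2 fun k => ?_)
  induction k with
  | zero => exact Eventually.of_forall fun n => Nat.zero_le n
  | succ k ih =>
    refine hidem _ ?_
    filter_upwards [ih] with n hn
    filter_upwards [h1] with m hm
    exact Nat.add_le_add hn hm

variable {E : Type*} [NormedAddCommGroup E] [NormedSpace ℝ E]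

/-- The idempotent operator `P` is a strong limit of `S` along a filter of times tending to
infinity. -/
structure IsLimitProjection (S : ℝ → E →L[ℝ] E) (l : Filter ℝ) (P : E →L[ℝ] E) : Prop where
  neBot : l.NeBot
  le_atTop : l ≤ atTop
  tendsto : ∀ y, Tendsto (fun t => S t y) l (𝓝 (P y))
  idem : ∀ y, P (P y) = P y

lemma exists_isLimitProjection [CompleteSpace E] {S : ℝ → E →L[ℝ] E} (hS : IsOperatorSemigroup S)
    {a : ℝ} (ha : 0 < a) (hess : essNorm (S a) < 1) {M : ℝ} (hM : ∀ n : ℕ, ‖S a ^ n‖ ≤ M) :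
    ∃ (l : Filter ℝ) (P : E →L[ℝ] E), IsLimitProjection S l P ∧
      ∀ y, S a y = y → P y = y := by
  obtain ⟨V, hV, hidem⟩ := exists_idempotent_ultrafilter_nat
  have hM0 : 0 ≤ M := (norm_nonneg _).trans (hM 0)
  choose p hp using fun y : E => exists_tendsto_of_net V (fun n : ℕ => (S a ^ n) y)
    fun ε hε => by
      obtain ⟨k, -, F, hF, hnet⟩ := exists_pow_net hess hε (M * ‖y‖)
      refine ⟨F, hF, ?_⟩
      filter_upwards [hV (eventually_ge_atTop k)] with n hn
      obtain ⟨c, hc, hlt⟩ := hnet ((S a ^ (n - k)) y)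
        (((S a ^ (n - k)).le_opNorm y).trans (by gcongr; exact hM _))
      refine ⟨c, hc, ?_⟩
      have h : (S a ^ n) y = (S a ^ k) ((S a ^ (n - k)) y) := by
        conv_lhs => rw [← Nat.add_sub_cancel' hn, pow_add]
        rfl
      rw [dist_eq_norm, h]; exact hlt
  let P₀ : E →ₗ[ℝ] E :=
    { toFun := p
      map_add' := fun y z => tendsto_nhds_unique (hp (y + z))
        (((hp y).add (hp z)).congr fun n => (map_add _ _ _).symm)
      map_smul' := fun c y => tendsto_nhds_unique (hp (c • y))
        (((hp y).const_smul c).congr fun n => (map_smul _ _ _).symm) }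
  let P : E →L[ℝ] E := P₀.mkContinuous M fun y => le_of_tendsto' (hp y).norm fun n =>
    ((S a ^ n).le_opNorm y).trans (by gcongr; exact hM n)
  have hP : ∀ y, Tendsto (fun n : ℕ => (S a ^ n) y) V (𝓝 (P y)) := hp
  refine ⟨map (fun n : ℕ => (n : ℝ) * a) V, P, ⟨inferInstance, ?_, fun y => ?_, fun y => ?_⟩,
    fun y hy => ?_⟩
  · exact ((tendsto_natCast_atTop_atTop.atTop_mul_const ha).mono_left hV : Tendsto _ _ _)
  · rw [tendsto_map'_iff]
    refine (hP y).congr' ?_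
    filter_upwards [hV (eventually_ge_atTop 1)] with n hn
    obtain ⟨m, rfl⟩ := Nat.exists_eq_succ_of_ne_zero (by omega : n ≠ 0)
    rw [Function.comp_apply, Nat.succ_eq_add_one, hS.nat_mul ha]
  -- `T ^ (n + m) y = T ^ n (T ^ m y)` is near `P (P y)` for most `n` and then most `m`; idempotency
  -- of `V` collapses the double limit to a single one.
  · refine tendsto_nhds_unique ?_ (hP y)
    rw [Metric.tendsto_nhds]
    intro ε hε
    refine hidem _ ?_
    filter_upwards [Metric.tendsto_nhds.1 (hP (P y)) (ε / 2) (half_pos hε)] with n hn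
    have h := (((S a ^ n).continuous.tendsto _).comp (hP y))
    filter_upwards [Metric.tendsto_nhds.1 h (ε / 2) (half_pos hε)] with m hm
    have := dist_triangle ((S a ^ (n + m)) y) ((S a ^ n) (P y)) (P (P y))
    rw [pow_add] at this ⊢
    exact this.trans_lt (by rw [← add_halves ε]; exact add_lt_add hm hn)
  · have h : ∀ n : ℕ, (S a ^ n) y = y := fun n => by
      induction n with
      | zero => rfl
      | succ n ih => rw [pow_succ]; change (S a ^ n) (S a y) = y; rw [hy, ih]
    refine tendsto_nhds_unique (hP y) ?_
    simp only [h]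
    exact tendsto_const_nhds

lemma exists_net {S : ℝ → E →L[ℝ] E} (hS : IsOperatorSemigroup S)
    {a : ℝ} (ha : 0 < a) (hess : essNorm (S a) < 1) {ε : ℝ} (hε : 0 < ε) (r : ℝ) :
    ∃ t : ℝ, 0 < t ∧ ∃ F : Set E, F.Finite ∧ ∀ y, ‖y‖ ≤ r → ∃ c ∈ F, ‖S t y - c‖ < ε := by
  obtain ⟨k, hk, F, hF, hnet⟩ := exists_pow_net hess hε r
  obtain ⟨m, rfl⟩ := Nat.exists_eq_succ_of_ne_zero hk.ne'
  refine ⟨(m + 1 : ℕ) * a, by positivity, F, hF, ?_⟩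
  rw [hS.nat_mul ha]
  exact hnet

end Projection

/-! ### Lattice structure and recurrence on the range of `P`. -/

section Range

variable {E : Type*} [NormedAddCommGroup E] [NormedSpace ℝ E] [Lattice E]
  [IsOrderedAddMonoid E] [IsOrderedModule ℝ E] [HasSolidNorm E]
  {S : ℝ → E →L[ℝ] E} {l : Filter ℝ} {P : E →L[ℝ] E}

lemma IsLimitProjection.nonneg (hP : IsLimitProjection S l P) (hpos : IsPositiveSemigroup S)
    {f : E} (hf : 0 ≤ f) : 0 ≤ P f := by
  have := hP.neBot
  refine ge_of_tendsto (hP.tendsto f) ?_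
  filter_upwards [hP.le_atTop (eventually_gt_atTop 0)] with t ht
  exact hpos t ht f hf

lemma IsLimitProjection.comm (hP : IsLimitProjection S l P) (hS : IsOperatorSemigroup S)
    {s : ℝ} (hs : 0 < s) (y : E) : P (S s y) = S s (P y) := by
  have := hP.neBot
  refine tendsto_nhds_unique (hP.tendsto (S s y))
    ((((S s).continuous.tendsto _).comp (hP.tendsto y)).congr' ?_)
  filter_upwards [hP.le_atTop (eventually_gt_atTop 0)] with t ht
  exact hS.apply_comm hs ht y

lemma IsLimitProjection.eq_zero_of_map_eq_zero (hP : IsLimitProjection S l P)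
    (hS : IsOperatorSemigroup S) (hpos : IsPositiveSemigroup S) (hirr : IsIrreducible S)
    (hP0 : ∃ x, 0 ≤ x ∧ P x ≠ 0) {z : E} (hz : 0 ≤ z) (hPz : P z = 0) : z = 0 := by
  by_contra hz0
  obtain ⟨x, hx, hPx⟩ := hP0
  have h := hirr.sublinear_nonpos (lt_of_le_of_ne hz (Ne.symm hz0)) (p := fun y => ‖P y⁺‖)
    (C := ‖P‖) (fun a b => by
      refine (norm_le_norm_of_nonneg_of_le (hP.nonneg hpos (posPart_nonneg _))
        (map_le_map_of_nonneg (fun f hf => hP.nonneg hpos hf) (posPart_add_le a b))).trans ?_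
      rw [map_add]; exact norm_add_le _ _)
    (fun c hc a => by
      rw [posPart_smul_of_pos hc, map_smul, norm_smul, Real.norm_of_nonneg hc.le])
    (fun a => P.le_opNorm _)
    (fun t ht => by
      rw [posPart_of_nonneg (hpos t ht z hz), hP.comm hS ht, hPz, map_zero, norm_zero]) x
  simp only [posPart_of_nonneg hx] at h
  exact hPx (norm_le_zero_iff.1 h)

/-- Positivity gives `|y| ≤ P |y|`; the difference is positive and killed by `P`, hence zero. -/
lemma IsLimitProjection.map_abs (hP : IsLimitProjection S l P) (hpos : IsPositiveSemigroup S)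
    (hstrict : ∀ z, 0 ≤ z → P z = 0 → z = 0) {y : E} (hy : P y = y) : P |y| = |y| := by
  have h1 : |y| ≤ P |y| := by
    have := abs_map_le (fun f hf => hP.nonneg hpos hf) (A := P) y
    rwa [hy] at this
  exact sub_eq_zero.1 (hstrict _ (sub_nonneg.2 h1) (by rw [map_sub, hP.idem, sub_self]))

lemma IsLimitProjection.map_inf (hP : IsLimitProjection S l P) (hpos : IsPositiveSemigroup S)
    (hstrict : ∀ z, 0 ≤ z → P z = 0 → z = 0) {x y : E} (hx : P x = x) (hy : P y = y) :
    P (x ⊓ y) = x ⊓ y := by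
  rw [inf_eq_half_smul_add_sub_abs_sub ℝ, map_smul, map_sub, map_add, hx, hy,
    hP.map_abs hpos hstrict (by rw [map_sub, hx, hy])]

lemma IsLimitProjection.map_posPart (hP : IsLimitProjection S l P) (hpos : IsPositiveSemigroup S)
    (hstrict : ∀ z, 0 ≤ z → P z = 0 → z = 0) {x : E} (hx : P x = x) : P x⁺ = x⁺ := by
  rw [posPart_def, sup_eq_half_smul_add_add_abs_sub ℝ, map_smul, map_add, map_add, map_zero, hx,
    hP.map_abs hpos hstrict (by rw [map_sub, map_zero, hx])]

/-- On the range of `P` the semigroup acts by lattice homomorphisms. -/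
lemma IsLimitProjection.abs_apply (hP : IsLimitProjection S l P) (hS : IsOperatorSemigroup S)
    (hpos : IsPositiveSemigroup S) (hstrict : ∀ z, 0 ≤ z → P z = 0 → z = 0)
    {s : ℝ} (hs : 0 < s) {y : E} (hy : P y = y) : |S s y| = S s |y| := by
  have := hP.neBot
  have hw : 0 ≤ S s |y| - |S s y| := sub_nonneg.2 (abs_map_le (hpos s hs) y)
  refine (sub_eq_zero.1 (hstrict _ hw (le_antisymm ?_ (hP.nonneg hpos hw)))).symm
  -- This limit is zero because `P` fixes both `y` and `|y|`; for `t > s` the expression dominates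
  -- `S t (S s |y| - |S s y|)`.
  have hlim : Tendsto (fun t => S s (S t |y| - |S t y|)) l (𝓝 (S s (P |y| - |P y|))) :=
    ((S s).continuous.tendsto _).comp
      ((hP.tendsto |y|).sub ((hP.tendsto y).sup_nhds (hP.tendsto y).neg))
  rw [hP.map_abs hpos hstrict hy, hy, sub_self, map_zero] at hlim
  refine le_of_tendsto_of_tendsto (hP.tendsto _) hlim ?_
  filter_upwards [hP.le_atTop (eventually_gt_atTop s)] with t ht
  have ht' : 0 < t - s := sub_pos.2 ht
  have key : ∀ z, S t z = S (t - s) (S s z) := fun z => by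
    rw [← hS.add_apply ht' hs, sub_add_cancel]
  rw [key, ← hS.apply_comm hs ht']
  refine map_le_map_of_nonneg (hpos s hs) ?_
  rw [key, key, map_sub]
  exact sub_le_sub_left (abs_map_le (hpos _ ht') _) _

lemma IsLimitProjection.apply_inf (hP : IsLimitProjection S l P) (hS : IsOperatorSemigroup S)
    (hpos : IsPositiveSemigroup S) (hstrict : ∀ z, 0 ≤ z → P z = 0 → z = 0)
    {s : ℝ} (hs : 0 < s) {x y : E} (hx : P x = x) (hy : P y = y) :
    S s (x ⊓ y) = S s x ⊓ S s y := by
  rw [inf_eq_half_smul_add_sub_abs_sub ℝ, inf_eq_half_smul_add_sub_abs_sub ℝ, map_smul, map_sub,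
    map_add, ← hP.abs_apply hS hpos hstrict hs (by rw [map_sub, hx, hy]), map_sub]

/-- Recurrence: `y` is the limit of `S (t - s) (S s y)`, so `S s` is bounded below on the range of
`P`. -/
lemma IsLimitProjection.norm_le (hP : IsLimitProjection S l P) (hS : IsOperatorSemigroup S)
    {M : ℝ} (hM : ∀ t, 0 < t → ‖S t‖ ≤ M) {s : ℝ} (hs : 0 < s) {y : E} (hy : P y = y) :
    ‖y‖ ≤ M * ‖S s y‖ := by
  have := hP.neBot
  have h := (hP.tendsto y).norm
  rw [hy] at h
  refine le_of_tendsto h ?_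
  filter_upwards [hP.le_atTop (eventually_gt_atTop s)] with t ht
  have ht' : 0 < t - s := sub_pos.2 ht
  have key : S t y = S (t - s) (S s y) := by rw [← hS.add_apply ht' hs, sub_add_cancel]
  rw [key]
  exact ((S (t - s)).le_opNorm _).trans (by gcongr; exact hM _ ht')

lemma IsLimitProjection.eq_zero_of_apply_eq_zero (hP : IsLimitProjection S l P)
    (hS : IsOperatorSemigroup S) {M : ℝ} (hM : ∀ t, 0 < t → ‖S t‖ ≤ M) {s : ℝ} (hs : 0 < s)
    {y : E} (hy : P y = y) (h : S s y = 0) : y = 0 := by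
  have := hP.norm_le hS hM hs hy
  rw [h, norm_zero, mul_zero] at this
  exact norm_le_zero_iff.1 this

lemma apply_nat_mul_of_apply_eq_smul (hS : IsOperatorSemigroup S) {s : ℝ} (hs : 0 < s) {y : E}
    {c : ℝ} (h : S s y = c • y) (n : ℕ) : S ((n + 1 : ℕ) * s) y = c ^ (n + 1) • y := by
  rw [hS.nat_mul hs]
  induction n with
  | zero => simpa using h
  | succ n ih =>
    rw [pow_succ, mul_apply_eq_comp, h, map_smul, ih, smul_smul, ← pow_succ']

/-- Boundedness excludes `c > 1`, and the lower bound `norm_le` excludes `c < 1`. -/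
lemma IsLimitProjection.eq_one_of_apply_eq_smul (hP : IsLimitProjection S l P)
    (hS : IsOperatorSemigroup S) {M : ℝ} (hM : ∀ t, 0 < t → ‖S t‖ ≤ M) {s : ℝ} (hs : 0 < s)
    {y : E} (hy : P y = y) (hy0 : y ≠ 0) {c : ℝ} (hc : 0 < c) (h : S s y = c • y) : c = 1 := by
  have hn : 0 < ‖y‖ := norm_pos_iff.2 hy0
  have h1 : ∀ n : ℕ, c ^ (n + 1) ≤ M := fun n => by
    have h2 := (S ((n + 1 : ℕ) * s)).le_opNorm y
    rw [apply_nat_mul_of_apply_eq_smul hS hs h, norm_smul, Real.norm_of_nonneg (by positivity)]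
      at h2
    exact (le_of_mul_le_mul_right h2 hn).trans (hM _ (by positivity))
  have h2 : ∀ n : ℕ, 1 ≤ M * c ^ (n + 1) := fun n => by
    have h2 := hP.norm_le hS hM (s := (n + 1 : ℕ) * s) (by positivity) hy
    rw [apply_nat_mul_of_apply_eq_smul hS hs h, norm_smul, Real.norm_of_nonneg (by positivity),
      ← mul_assoc] at h2
    exact le_of_mul_le_mul_right (by rwa [one_mul]) hn
  have hM0 : 0 < M := lt_of_lt_of_le (by positivity) (h1 0)
  rcases lt_trichotomy c 1 with hlt | heq | hgt
  · obtain ⟨n, hn'⟩ := exists_pow_lt_of_lt_one (inv_pos.2 hM0) hlt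
    have h3 : c ^ (n + 1) ≤ c ^ n := pow_le_pow_of_le_one hc.le hlt.le (Nat.le_succ n)
    have h4 : M * c ^ (n + 1) < M * M⁻¹ := by gcongr; exact h3.trans_lt hn'
    rw [mul_inv_cancel₀ hM0.ne'] at h4
    exact absurd (h2 n) h4.not_ge
  · exact heq
  · obtain ⟨n, hn'⟩ := pow_unbounded_of_one_lt M hgt
    have h3 : c ^ n ≤ c ^ (n + 1) := pow_le_pow_right₀ hgt.le (Nat.le_succ n)
    exact absurd (h1 n) (hn'.trans_le h3).not_ge

end Range

/-! ### Atoms of the range of `P`. -/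

section Families

variable {E : Type*} [NormedAddCommGroup E] [NormedSpace ℝ E] [Lattice E]
  [IsOrderedAddMonoid E] [IsOrderedModule ℝ E] [HasSolidNorm E]
  {S : ℝ → E →L[ℝ] E} {l : Filter ℝ} {P : E →L[ℝ] E}

/-- A family of pairwise disjoint, strictly positive fixed vectors of `P`. -/
structure IsDisjointFamily (P : E →L[ℝ] E) {ι : Type*} (f : ι → E) : Prop where
  pos : ∀ i, 0 < f i
  fixed : ∀ i, P (f i) = f i
  inf_eq_zero : ∀ i j, i ≠ j → f i ⊓ f j = 0

lemma inf_eq_zero_of_le {a b e f : E} (ha : 0 ≤ a) (hb : 0 ≤ b) (hae : a ≤ e) (hbf : b ≤ f)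
    (h : e ⊓ f = 0) : a ⊓ b = 0 :=
  le_antisymm ((inf_le_inf hae hbf).trans h.le) (le_inf ha hb)

lemma smul_inf_smul_eq_zero {e f : E} (he : 0 ≤ e) (hf : 0 ≤ f) (h : e ⊓ f = 0) {a b : ℝ}
    (ha : 0 < a) (hb : 0 < b) : (a • e) ⊓ (b • f) = 0 := by
  refine inf_eq_zero_of_le (smul_nonneg ha.le he) (smul_nonneg hb.le hf)
    (smul_le_smul_of_nonneg_right (le_add_of_nonneg_right hb.le) he)
    (smul_le_smul_of_nonneg_right (le_add_of_nonneg_left ha.le) hf) ?_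
  rw [← smul_inf_of_pos (add_pos ha hb), h, smul_zero]

lemma norm_le_norm_sub_of_inf_eq_zero {e f : E} (he : 0 ≤ e) (hf : 0 ≤ f) (h : e ⊓ f = 0) :
    ‖e‖ ≤ ‖e - f‖ := by
  have h1 : |e - f| = e + f := by
    rw [abs_sub_comm, ← sup_sub_inf_eq_abs_sub, h, sub_zero, ← inf_add_sup, h, zero_add]
  rw [← norm_abs_eq_norm (e - f), h1]
  exact norm_le_norm_of_nonneg_of_le he (le_add_of_nonneg_right hf)

lemma IsDisjointFamily.cons {N : ℕ} {f : Fin N → E} (hf : IsDisjointFamily P f) {w : E}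
    (hw : 0 < w) (hPw : P w = w) (hd : ∀ i, w ⊓ f i = 0) :
    IsDisjointFamily P (Fin.cons w f : Fin (N + 1) → E) where
  pos := Fin.cases hw hf.pos
  fixed := Fin.cases hPw hf.fixed
  inf_eq_zero := by
    refine Fin.cases (Fin.cases (fun h => absurd rfl h) fun j _ => hd j) fun i =>
      Fin.cases (fun _ => ?_) fun j h => hf.inf_eq_zero i j fun h' => h (congrArg _ h')
    rw [inf_comm]; exact hd i

lemma IsDisjointFamily.inf_eq_zero_of_le_smul {ι : Type*} {f : ι → E}
    (hf : IsDisjointFamily P f) {i j : ι} (hij : i ≠ j) {w : E} (hw : 0 ≤ w) {c : ℝ} (hc : 0 < c)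
    (hle : w ≤ c • f i) : w ⊓ f j = 0 := by
  refine inf_eq_zero_of_le hw (hf.pos j).le hle (one_smul ℝ (f j)).ge ?_
  exact smul_inf_smul_eq_zero (hf.pos i).le (hf.pos j).le (hf.inf_eq_zero i j hij) hc one_pos

lemma IsDisjointFamily.update {ι : Type*} [DecidableEq ι] {f : ι → E}
    (hf : IsDisjointFamily P f) (i : ι) {w : E} (hw : 0 < w) (hPw : P w = w) {c : ℝ} (hc : 0 < c)
    (hle : w ≤ c • f i) : IsDisjointFamily P (Function.update f i w) where
  pos j := by
    rcases eq_or_ne j i with rfl | h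
    · simpa using hw
    · simpa [h] using hf.pos j
  fixed j := by
    rcases eq_or_ne j i with rfl | h
    · simpa using hPw
    · simpa [h] using hf.fixed j
  inf_eq_zero j k hjk := by
    rcases eq_or_ne j i with rfl | hj
    · simpa [hjk.symm] using hf.inf_eq_zero_of_le_smul hjk hw.le hc hle
    · rcases eq_or_ne k i with rfl | hk
      · rw [inf_comm]
        simpa [hj] using hf.inf_eq_zero_of_le_smul hj.symm hw.le hc hle
      · simpa [hj, hk] using hf.inf_eq_zero j k hjk

/-- Normalized disjoint vectors are at distance at least `1`, while recurrence puts each within `1 /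
2` of a fixed finite set; so distinct members need distinct net points. -/
lemma IsLimitProjection.exists_card_le (hP : IsLimitProjection S l P)
    (hS : IsOperatorSemigroup S) {a : ℝ} (ha : 0 < a) (hess : essNorm (S a) < 1) {M : ℝ}
    (hM : ∀ t, 0 < t → ‖S t‖ ≤ M) :
    ∃ B : ℕ, ∀ (N : ℕ) (f : Fin N → E), IsDisjointFamily P f → N ≤ B := by
  have := hP.neBot
  obtain ⟨s, hs, F, hF, hnet⟩ := exists_net hS ha hess (ε := 1 / 4) (by norm_num) M
  have hclose : ∀ e, P e = e → ‖e‖ = 1 → ∃ c ∈ F, ‖e - c‖ < 1 / 2 := fun e he he1 => by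
    have h1 := hP.tendsto e
    rw [he] at h1
    obtain ⟨t, ht1, ht2⟩ := ((Metric.tendsto_nhds.1 h1 (1 / 4) (by norm_num)).and
      (hP.le_atTop (eventually_gt_atTop s))).exists
    have ht' : 0 < t - s := sub_pos.2 ht2
    have key : S t e = S s (S (t - s) e) := by rw [← hS.add_apply hs ht', add_sub_cancel]
    obtain ⟨c, hc, hlt⟩ := hnet (S (t - s) e) (by
      have := (S (t - s)).le_opNorm e
      rw [he1, mul_one] at this
      exact this.trans (hM _ ht'))
    refine ⟨c, hc, ?_⟩
    rw [← key] at hlt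
    have h3 := dist_triangle_left e c (S t e)
    rw [dist_eq_norm e c, dist_eq_norm (S t e) c] at h3
    linarith
  refine ⟨hF.toFinset.card, fun N f hf => ?_⟩
  have hn : ∀ i, 0 < ‖f i‖ := fun i => norm_pos_iff.2 (hf.pos i).ne'
  have hu : ∀ i, ‖‖f i‖⁻¹ • f i‖ = 1 := fun i => by
    rw [norm_smul, norm_inv, norm_norm, inv_mul_cancel₀ (hn i).ne']
  choose c hc hlt using fun i => hclose (‖f i‖⁻¹ • f i) (by rw [map_smul, hf.fixed]) (hu i)
  have hinj : Function.Injective fun i => (⟨c i, hF.mem_toFinset.2 (hc i)⟩ : hF.toFinset) := by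
    intro i j hij
    by_contra hne
    have hcij : c i = c j := congrArg Subtype.val hij
    have h1 := norm_le_norm_sub_of_inf_eq_zero
      (smul_nonneg (inv_pos.2 (hn i)).le (hf.pos i).le)
      (smul_nonneg (inv_pos.2 (hn j)).le (hf.pos j).le)
      (smul_inf_smul_eq_zero (hf.pos i).le (hf.pos j).le (hf.inf_eq_zero i j hne)
        (inv_pos.2 (hn i)) (inv_pos.2 (hn j)))
    have h2 := dist_triangle_right (‖f i‖⁻¹ • f i) (‖f j‖⁻¹ • f j) (c i)
    rw [dist_eq_norm, dist_eq_norm, dist_eq_norm] at h2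
    have h3 := hlt i
    have h4 := hlt j
    rw [← hcij] at h4
    rw [hu] at h1
    linarith
  have := Fintype.card_le_of_injective _ hinj
  rwa [Fintype.card_fin, Fintype.card_coe] at this

lemma exists_maximal_disjointFamily {B : ℕ}
    (hB : ∀ (N : ℕ) (f : Fin N → E), IsDisjointFamily P f → N ≤ B) :
    ∃ N : ℕ, (∃ f : Fin N → E, IsDisjointFamily P f) ∧
      ∀ f : Fin (N + 1) → E, ¬ IsDisjointFamily P f := by
  by_contra! h
  have hall : ∀ N : ℕ, ∃ f : Fin N → E, IsDisjointFamily P f := fun N => by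
    induction N with
    | zero => exact ⟨Fin.elim0, fun i => i.elim0, fun i => i.elim0, fun i => i.elim0⟩
    | succ N ih => exact h N ih
  obtain ⟨f, hf⟩ := hall (B + 1)
  exact absurd (hB _ f hf) (by omega)

variable {N : ℕ} {f g : Fin N → E}

/-- Members of a disjoint family of maximal size are atoms of the range of `P`. -/
lemma IsDisjointFamily.eq_zero_or_eq_zero (hf : IsDisjointFamily P f)
    (hmax : ∀ f : Fin (N + 1) → E, ¬ IsDisjointFamily P f) (i : Fin N) {w v : E} (hw : 0 ≤ w)
    (hv : 0 ≤ v) (hPw : P w = w) (hPv : P v = v) (hwv : w ⊓ v = 0) {c : ℝ} (hc : 0 < c)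
    (hwc : w ≤ c • f i) (hvc : v ≤ c • f i) : w = 0 ∨ v = 0 := by
  by_contra! h
  have hw' : 0 < w := lt_of_le_of_ne hw h.1.symm
  have hv' : 0 < v := lt_of_le_of_ne hv h.2.symm
  refine hmax _ ((hf.update i hv' hPv hc hvc).cons hw' hPw fun j => ?_)
  rcases eq_or_ne j i with rfl | hj
  · simpa using hwv
  · simpa [hj] using hf.inf_eq_zero_of_le_smul hj.symm hw hc hwc

/-- The positive and negative parts of `z - c • f i` are disjoint and lie below a multiple of the
atom, so one vanishes; thus `z` is comparable to every `c • f i`. -/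
lemma IsDisjointFamily.exists_eq_smul_of_le (hf : IsDisjointFamily P f)
    (hmax : ∀ f : Fin (N + 1) → E, ¬ IsDisjointFamily P f)
    (hP : IsLimitProjection S l P) (hpos : IsPositiveSemigroup S)
    (hstrict : ∀ z, 0 ≤ z → P z = 0 → z = 0) (i : Fin N) {z : E} (hz : 0 ≤ z) (hPz : P z = z)
    (hzi : z ≤ f i) : ∃ c : ℝ, z = c • f i := by
  refine exists_eq_smul_of_forall_le_or_ge (hf.pos i) fun c => ?_
  rcases le_or_gt c 0 with hc | hc
  · exact Or.inr ((smul_nonpos_of_nonpos_of_nonneg hc (hf.pos i).le).trans hz)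
  have hfix : P (z - c • f i) = z - c • f i := by rw [map_sub, map_smul, hPz, hf.fixed]
  have hcf : 0 ≤ c • f i := smul_nonneg hc.le (hf.pos i).le
  have h1 : (z - c • f i)⁺ ≤ z := sup_le (sub_le_self _ hcf) hz
  have h2 : (z - c • f i)⁻ ≤ c • f i :=
    sup_le (by rw [neg_sub]; exact sub_le_self _ hz) hcf
  have h3 : P (z - c • f i)⁻ = (z - c • f i)⁻ := by
    rw [← posPart_neg]
    exact hP.map_posPart hpos hstrict (by rw [map_neg, hfix])
  rcases hf.eq_zero_or_eq_zero hmax i (posPart_nonneg _) (negPart_nonneg _)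
    (hP.map_posPart hpos hstrict hfix) h3 (posPart_inf_negPart_eq_zero _)
    (c := 1 + c) (by linarith)
    (h1.trans (hzi.trans (by
      rw [add_smul, one_smul]; exact le_add_of_nonneg_right hcf)))
    (h2.trans (by rw [add_smul, one_smul]; exact le_add_of_nonneg_left (hf.pos i).le))
    with h | h
  · exact Or.inl (sub_nonpos.1 (posPart_eq_zero.1 h))
  · exact Or.inr (sub_nonneg.1 (negPart_eq_zero.1 h))

lemma IsDisjointFamily.exists_eq_smul_of_inf_ne_zero (hf : IsDisjointFamily P f)
    (hg : IsDisjointFamily P g) (hmax : ∀ f : Fin (N + 1) → E, ¬ IsDisjointFamily P f)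
    (hP : IsLimitProjection S l P) (hpos : IsPositiveSemigroup S)
    (hstrict : ∀ z, 0 ≤ z → P z = 0 → z = 0) {i j : Fin N} (hij : f i ⊓ g j ≠ 0) :
    ∃ c : ℝ, 0 < c ∧ g j = c • f i := by
  have hz : 0 ≤ f i ⊓ g j := le_inf (hf.pos i).le (hg.pos j).le
  have hz' : 0 < f i ⊓ g j := lt_of_le_of_ne hz hij.symm
  have hPz : P (f i ⊓ g j) = f i ⊓ g j := hP.map_inf hpos hstrict (hf.fixed i) (hg.fixed j)
  obtain ⟨a, ha⟩ := hf.exists_eq_smul_of_le hmax hP hpos hstrict i hz hPz inf_le_left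
  obtain ⟨b, hb⟩ := hg.exists_eq_smul_of_le hmax hP hpos hstrict j hz hPz inf_le_right
  have ha0 : 0 < a := by
    by_contra! h
    exact hz'.not_ge (ha.trans_le (smul_nonpos_of_nonpos_of_nonneg h (hf.pos i).le))
  have hb0 : 0 < b := by
    by_contra! h
    exact hz'.not_ge (hb.trans_le (smul_nonpos_of_nonpos_of_nonneg h (hg.pos j).le))
  refine ⟨b⁻¹ * a, by positivity, ?_⟩
  rw [mul_smul, ← ha, hb, smul_smul, inv_mul_cancel₀ hb0.ne', one_smul]

lemma IsDisjointFamily.apply (hf : IsDisjointFamily P f) (hP : IsLimitProjection S l P)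
    (hS : IsOperatorSemigroup S) (hpos : IsPositiveSemigroup S)
    (hstrict : ∀ z, 0 ≤ z → P z = 0 → z = 0) {M : ℝ} (hM : ∀ t, 0 < t → ‖S t‖ ≤ M)
    {s : ℝ} (hs : 0 < s) : IsDisjointFamily P fun i => S s (f i) where
  pos i := lt_of_le_of_ne (hpos s hs _ (hf.pos i).le) fun h =>
    (hf.pos i).ne' (hP.eq_zero_of_apply_eq_zero hS hM hs (hf.fixed i) h.symm)
  fixed i := by rw [hP.comm hS hs, hf.fixed]
  inf_eq_zero i j hij := by
    rw [← hP.apply_inf hS hpos hstrict hs (hf.fixed i) (hf.fixed j), hf.inf_eq_zero i j hij,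
      map_zero]

/-- The semigroup permutes the atoms of the range of `P` up to positive factors. -/
lemma IsDisjointFamily.exists_apply_eq_smul (hf : IsDisjointFamily P f)
    (hmax : ∀ f : Fin (N + 1) → E, ¬ IsDisjointFamily P f) (hP : IsLimitProjection S l P)
    (hS : IsOperatorSemigroup S) (hpos : IsPositiveSemigroup S)
    (hstrict : ∀ z, 0 ≤ z → P z = 0 → z = 0) {M : ℝ} (hM : ∀ t, 0 < t → ‖S t‖ ≤ M)
    {s : ℝ} (hs : 0 < s) (i : Fin N) : ∃ (j : Fin N) (c : ℝ), 0 < c ∧ S s (f i) = c • f j := by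
  have hg := hf.apply hP hS hpos hstrict hM hs
  obtain ⟨j, hj⟩ : ∃ j, f j ⊓ S s (f i) ≠ 0 := by
    by_contra! h
    exact hmax _ (hf.cons (hg.pos i) (hg.fixed i) fun j => by rw [inf_comm]; exact h j)
  obtain ⟨c, hc, h⟩ := hf.exists_eq_smul_of_inf_ne_zero hg hmax hP hpos hstrict hj
  exact ⟨j, c, hc, h⟩

/-- Since times are divisible, the semigroup fixes every atom of the range of `P`. -/
lemma IsDisjointFamily.apply_eq_self (hf : IsDisjointFamily P f)
    (hmax : ∀ f : Fin (N + 1) → E, ¬ IsDisjointFamily P f) (hP : IsLimitProjection S l P)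
    (hS : IsOperatorSemigroup S) (hpos : IsPositiveSemigroup S)
    (hstrict : ∀ z, 0 ≤ z → P z = 0 → z = 0) {M : ℝ} (hM : ∀ t, 0 < t → ‖S t‖ ≤ M)
    {t : ℝ} (ht : 0 < t) (i : Fin N) : S t (f i) = f i := by
  have hfac : (0 : ℝ) < N.factorial := by exact_mod_cast N.factorial_pos
  set s : ℝ := t / N.factorial with hs_def
  have hs : 0 < s := div_pos ht hfac
  have hks : ∀ k : Fin (N + 1), 0 < ((k : ℕ) + 1 : ℝ) * s := fun k => by positivity
  -- Pigeonhole over the `N + 1` times `(k + 1) * s`, shifted by one because time must be positive.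
  -- Two of them hit the same atom, and their index gap `d + 1 ≤ N` divides `N!`.
  choose σ c hc hσ using fun k : Fin (N + 1) =>
    hf.exists_apply_eq_smul hmax hP hS hpos hstrict hM (hks k) i
  obtain ⟨k, m, hkm, hσkm⟩ : ∃ k m : Fin (N + 1), k < m ∧ σ k = σ m := by
    obtain ⟨k, m, hne, h⟩ := Fintype.exists_ne_map_eq_of_card_lt σ (by simp)
    rcases lt_or_gt_of_ne hne with hlt | hlt
    · exact ⟨k, m, hlt, h⟩
    · exact ⟨m, k, hlt, h.symm⟩
  obtain ⟨d, hd⟩ : ∃ d : ℕ, (m : ℕ) = k + (d + 1) := ⟨m - k - 1, by omega⟩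
  have hdN : d + 1 ∣ N.factorial := Nat.dvd_factorial (by omega) (by omega)
  have hds : 0 < ((d + 1 : ℕ) : ℝ) * s := by positivity
  have hg := hf.apply hP hS hpos hstrict hM (hks k)
  have hmul : S ((d + 1 : ℕ) * s) (S (((k : ℕ) + 1 : ℝ) * s) (f i)) =
      (c m / c k) • S (((k : ℕ) + 1 : ℝ) * s) (f i) := by
    rw [← hS.add_apply hds (hks k), hσ k, smul_smul, div_mul_cancel₀ _ (hc k).ne', hσkm, ← hσ m]
    congr 2
    rw [hd]; push_cast; ring
  have h1 := hP.eq_one_of_apply_eq_smul hS hM hds (hg.fixed i) (hg.pos i).ne'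
    (div_pos (hc m) (hc k)) hmul
  rw [h1, one_smul, hS.apply_comm hds (hks k)] at hmul
  -- Injectivity of `S ((k + 1) * s)` on the range of `P` pulls the fixed-point identity back to `f
  -- i`.
  have hfixed : S ((d + 1 : ℕ) * s) (f i) = f i := by
    refine sub_eq_zero.1 (hP.eq_zero_of_apply_eq_zero hS hM (hks k) ?_
      (by rw [map_sub, hmul, sub_self]))
    rw [map_sub, hP.comm hS hds, hf.fixed]
  obtain ⟨q, hq⟩ := hdN
  obtain ⟨r, rfl⟩ : ∃ r, q = r + 1 := Nat.exists_eq_succ_of_ne_zero (by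
    rintro rfl
    exact N.factorial_pos.ne' hq)
  have h2 := apply_nat_mul_of_apply_eq_smul hS hds (c := 1) (by rw [hfixed, one_smul]) r
  rw [one_pow, one_smul] at h2
  convert h2 using 2
  rw [hs_def, hq]
  push_cast
  field_simp

/-- The functional `⨅ a, ‖(y - a • e)⁺‖` is sublinear and vanishes on the constant orbit of `e`,
hence everywhere; and `v - v ⊓ n • e = (v - n • e)⁺`. -/
lemma isQuasiInterior_of_fixed (hirr : IsIrreducible S) {e : E} (he : 0 < e)
    (hfix : ∀ t, 0 < t → S t e = e) : IsQuasiInterior e := by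
  refine ⟨he.le, fun v hv => ?_⟩
  have hbdd : ∀ y : E, BddBelow (Set.range fun a : ℝ => ‖(y - a • e)⁺‖) := fun y =>
    ⟨0, by rintro _ ⟨a, rfl⟩; exact norm_nonneg _⟩
  have hp := hirr.sublinear_nonpos he (p := fun y => ⨅ a : ℝ, ‖(y - a • e)⁺‖) (C := 1)
    (fun y z => by
      refine le_of_forall_pos_le_add fun ε hε => ?_
      obtain ⟨a, ha⟩ := exists_lt_of_ciInf_lt
        (lt_add_of_pos_right (⨅ a : ℝ, ‖(y - a • e)⁺‖) (half_pos hε))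
      obtain ⟨b, hb⟩ := exists_lt_of_ciInf_lt
        (lt_add_of_pos_right (⨅ a : ℝ, ‖(z - a • e)⁺‖) (half_pos hε))
      refine (ciInf_le (hbdd (y + z)) (a + b)).trans ?_
      have h1 : y + z - (a + b) • e = (y - a • e) + (z - b • e) := by rw [add_smul]; abel
      have h2 : ‖(y + z - (a + b) • e)⁺‖ ≤ ‖(y - a • e)⁺‖ + ‖(z - b • e)⁺‖ := by
        rw [h1]
        exact (norm_le_norm_of_nonneg_of_le (posPart_nonneg _) (posPart_add_le _ _)).trans
          (norm_add_le _ _)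
      linarith)
    (fun c hc y => by
      rw [Real.mul_iInf_of_nonneg hc.le]
      refine le_ciInf fun a => (ciInf_le (hbdd (c • y)) (c * a)).trans ?_
      rw [mul_smul, ← smul_sub, posPart_smul_of_pos hc, norm_smul, Real.norm_of_nonneg hc.le])
    (fun y => (ciInf_le (hbdd y) 0).trans (by simp))
    (fun t ht => (ciInf_le (hbdd _) 1).trans (by simp [hfix t ht])) v
  rw [Metric.tendsto_atTop]
  intro ε hε
  obtain ⟨a, ha⟩ := exists_lt_of_ciInf_lt (hp.trans_lt hε)
  refine ⟨⌈a⌉₊, fun n hn => ?_⟩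
  have han : a ≤ n := Nat.ceil_le.1 hn
  rw [dist_comm, dist_eq_norm, inf_eq_sub_posPart_sub, sub_sub_cancel]
  refine (norm_le_norm_of_nonneg_of_le (posPart_nonneg _) (posPart_mono ?_)).trans_lt ha
  exact sub_le_sub_left (smul_le_smul_of_nonneg_right han he.le) v

lemma IsQuasiInterior.eq_zero_of_inf_eq_zero {e v : E} (he : IsQuasiInterior e) (hv : 0 ≤ v)
    (h : v ⊓ e = 0) : v = 0 := by
  refine tendsto_nhds_unique (he.2 v hv) (tendsto_const_nhds.congr' ?_)
  filter_upwards [eventually_gt_atTop 0] with n hn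
  have := smul_inf_smul_eq_zero hv he.1 h one_pos (Nat.cast_pos.2 hn : (0 : ℝ) < n)
  rw [one_smul] at this
  exact this.symm

/-- The range of `P` is spanned by a fixed quasi-interior point. -/
lemma IsLimitProjection.exists_spanning (hP : IsLimitProjection S l P)
    (hS : IsOperatorSemigroup S) (hpos : IsPositiveSemigroup S) (hirr : IsIrreducible S)
    (hstrict : ∀ z, 0 ≤ z → P z = 0 → z = 0) {a : ℝ} (ha : 0 < a) (hess : essNorm (S a) < 1)
    {M : ℝ} (hM : ∀ t, 0 < t → ‖S t‖ ≤ M) (hx : ∃ x, 0 < x ∧ P x = x) :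
    ∃ e : E, 0 < e ∧ IsQuasiInterior e ∧ P e = e ∧ (∀ t, 0 < t → S t e = e) ∧
      ∀ y, ∃ c : ℝ, P y = c • e := by
  obtain ⟨B, hB⟩ := hP.exists_card_le hS ha hess hM
  obtain ⟨N, ⟨f, hf⟩, hmax⟩ := exists_maximal_disjointFamily hB
  obtain ⟨x, hx0, hPx⟩ := hx
  rcases Nat.eq_zero_or_pos N with rfl | hN
  · exact absurd ⟨fun _ => hx0, fun _ => hPx, fun i j h => absurd (Subsingleton.elim (α := Fin 1) i j) h⟩
      (hmax fun _ => x)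
  set i : Fin N := ⟨0, hN⟩
  have hfix : ∀ t, 0 < t → S t (f i) = f i := fun t ht =>
    hf.apply_eq_self hmax hP hS hpos hstrict hM ht i
  have hq : IsQuasiInterior (f i) := isQuasiInterior_of_fixed hirr (hf.pos i) hfix
  refine ⟨f i, hf.pos i, hq, hf.fixed i, hfix, fun y => ?_⟩
  refine exists_eq_smul_of_forall_le_or_ge (hf.pos i) fun c => ?_
  set z := P y - c • f i
  have hz : P z = z := by rw [map_sub, map_smul, hP.idem, hf.fixed]
  have hz1 := hP.map_posPart hpos hstrict hz
  have hz2 : P z⁻ = z⁻ := by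
    rw [← posPart_neg]
    exact hP.map_posPart hpos hstrict (by rw [map_neg, hz])
  have hnn : ∀ {w : E}, 0 ≤ w → 0 ≤ w ⊓ f i := fun hw => le_inf hw (hf.pos i).le
  -- Meeting `z⁺` and `z⁻` with the atom gives disjoint fixed vectors below it, so one meet is zero;
  -- quasi-interiority then kills that part of `z`.
  rcases hf.eq_zero_or_eq_zero hmax i (hnn (posPart_nonneg z)) (hnn (negPart_nonneg z))
    (hP.map_inf hpos hstrict hz1 (hf.fixed i)) (hP.map_inf hpos hstrict hz2 (hf.fixed i))
    (inf_eq_zero_of_le (hnn (posPart_nonneg z)) (hnn (negPart_nonneg z)) inf_le_left inf_le_left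
      (posPart_inf_negPart_eq_zero z)) one_pos
    (by rw [one_smul]; exact inf_le_right) (by rw [one_smul]; exact inf_le_right) with h | h
  · exact Or.inl (sub_nonpos.1
      (posPart_eq_zero.1 (hq.eq_zero_of_inf_eq_zero (posPart_nonneg z) h)))
  · exact Or.inr (sub_nonneg.1
      (negPart_eq_zero.1 (hq.eq_zero_of_inf_eq_zero (negPart_nonneg z) h)))

end Families

/-! ### From the limit projection to norm convergence. -/

section Convergence

variable {E : Type*} [NormedAddCommGroup E] [NormedSpace ℝ E] {S : ℝ → E →L[ℝ] E} {l : Filter ℝ}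
  {P : E →L[ℝ] E}

lemma IsLimitProjection.tendsto_apply (hP : IsLimitProjection S l P)
    (hS : IsOperatorSemigroup S) {M : ℝ} (hM : ∀ t, 0 < t → ‖S t‖ ≤ M)
    (hfix : ∀ t, 0 < t → ∀ y, S t (P y) = P y) (y : E) :
    Tendsto (fun t => S t y) atTop (𝓝 (P y)) := by
  have := hP.neBot
  have hM0 : 0 ≤ M := (norm_nonneg _).trans (hM 1 one_pos)
  rw [Metric.tendsto_atTop]
  intro ε hε
  obtain ⟨s, hs1, hs⟩ := ((Metric.tendsto_nhds.1 (hP.tendsto y) (ε / (M + 1)) (by positivity)).and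
    (hP.le_atTop (eventually_gt_atTop 0))).exists
  refine ⟨s + 1, fun t ht => ?_⟩
  have ht' : 0 < t - s := by linarith
  have key : S t y - P y = S (t - s) (S s y - P y) := by
    rw [map_sub, ← hS.add_apply ht' hs, sub_add_cancel, hfix _ ht']
  rw [dist_eq_norm] at hs1 ⊢
  rw [key]
  calc ‖S (t - s) (S s y - P y)‖ ≤ M * ‖S s y - P y‖ :=
        ((S (t - s)).le_opNorm _).trans (by gcongr; exact hM _ ht')
    _ ≤ (M + 1) * ‖S s y - P y‖ := by gcongr; linarith
    _ < ε := by rwa [lt_div_iff₀ (by positivity), mul_comm] at hs1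

/-- Since `P ∘ S s = P`, one has `S t - P = (S (t - s) - P) ∘ S s`, and `S s` sends the unit ball
near a finite set, on which strong convergence is uniform. -/
lemma tendsto_of_tendsto_apply (hS : IsOperatorSemigroup S) {a : ℝ} (ha : 0 < a)
    (hess : essNorm (S a) < 1) {M : ℝ} (hM : ∀ t, 0 < t → ‖S t‖ ≤ M)
    (hPS : ∀ t, 0 < t → ∀ y, P (S t y) = P y)
    (hlim : ∀ y, Tendsto (fun t => S t y) atTop (𝓝 (P y))) : Tendsto S atTop (𝓝 P) := by
  have hM0 : 0 ≤ M := (norm_nonneg _).trans (hM 1 one_pos)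
  rw [Metric.tendsto_nhds]
  intro ε hε
  set C := M + ‖P‖ + 1
  have hC : 0 < C := by positivity
  obtain ⟨s, hs, F, hF, hnet⟩ := exists_net hS ha hess (ε := ε / (4 * C)) (by positivity) 1
  have hsmall : ∀ᶠ t in atTop, ∀ c ∈ F, dist (S t c) (P c) < ε / 4 :=
    (eventually_all_finite hF).2 fun c _ => Metric.tendsto_nhds.1 (hlim c) _ (by positivity)
  have hshift := (tendsto_atTop_add_const_right atTop (-s) tendsto_id).eventually hsmall
  filter_upwards [hshift, eventually_gt_atTop s] with t ht hts
  have ht' : 0 < t - s := sub_pos.2 hts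
  rw [dist_eq_norm]
  refine lt_of_le_of_lt (ContinuousLinearMap.opNorm_le_of_unit_norm (half_pos hε).le
    fun y hy => ?_) (half_lt_self hε)
  obtain ⟨c, hc, hlt⟩ := hnet y hy.le
  have h1 : ‖S (t - s) c - P c‖ < ε / 4 := by rw [← dist_eq_norm]; exact ht c hc
  have h2 : (S t - P) y = (S (t - s) c - P c) + (S (t - s) - P) (S s y - c) := by
    rw [sub_apply, sub_apply, map_sub, map_sub,
      ← hS.add_apply ht' hs, sub_add_cancel, hPS s hs]
    abel
  have h3 : ‖S (t - s) - P‖ ≤ C := (norm_sub_le _ _).trans (by linarith [hM _ ht'])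
  have h4 : ‖(S (t - s) - P) (S s y - c)‖ ≤ C * (ε / (4 * C)) :=
    ((S (t - s) - P).le_opNorm _).trans (by gcongr)
  have h5 : C * (ε / (4 * C)) = ε / 4 := by field_simp
  rw [h2]
  exact (norm_add_le _ _).trans (by linarith)

end Convergence

end PosSemigroup

theorem mainTheorem1 {E : Type*} [NormedAddCommGroup E] [NormedSpace ℝ E] [CompleteSpace E]
    [Lattice E] [IsOrderedAddMonoid E] [IsOrderedModule ℝ E] [HasSolidNorm E]
    (S : ℝ → E →L[ℝ] E)
    (hS : PosSemigroup.IsOperatorSemigroup S)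
    (hpos : PosSemigroup.IsPositiveSemigroup S)
    (hirr : PosSemigroup.IsIrreducible S)
    (hgrowth : PosSemigroup.growthBound S = 0)
    (hcomp : PosSemigroup.IsAsymptoticallyCompact S) :
    PosSemigroup.IsBoundedSemigroup S ∧
      ∃ (u : E) (φ : StrongDual ℝ E), PosSemigroup.IsQuasiInterior u ∧
        PosSemigroup.IsStrictlyPositive φ ∧
        Tendsto S atTop (𝓝 (φ.smulRight u)) := by
  obtain ⟨a, ha, hess⟩ := hcomp
  obtain ⟨x, hx, hfix⟩ := PosSemigroup.exists_fixed_of_approx hess fun ε hε =>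
    PosSemigroup.exists_approx_fixed (hpos a ha)
      (fun r h0 h1 => PosSemigroup.summable_smul_pow hS hgrowth ha h0 h1)
      (fun n => by
        rw [← hS.nat_mul ha]
        exact PosSemigroup.one_le_norm_of_growthBound_eq_zero hS hgrowth (by positivity)) hε
  obtain ⟨M₀, hM₀⟩ := PosSemigroup.exists_norm_pow_le hS hpos hirr ha hess hx hfix
  have hbdd := PosSemigroup.isBoundedSemigroup_of_norm_pow_le hS hgrowth ha hM₀
  refine ⟨hbdd, ?_⟩
  obtain ⟨M, hM⟩ := hbdd
  obtain ⟨l, P, hP, hPfix⟩ := PosSemigroup.exists_isLimitProjection hS ha hess hM₀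
  have hPx : P x = x := hPfix x hfix
  have hstrict : ∀ z, 0 ≤ z → P z = 0 → z = 0 := fun z hz h =>
    hP.eq_zero_of_map_eq_zero hS hpos hirr ⟨x, hx.le, by rw [hPx]; exact hx.ne'⟩ hz h
  obtain ⟨e, he, hq, -, hSe, hspan⟩ :=
    hP.exists_spanning hS hpos hirr hstrict ha hess hM ⟨x, hx, hPx⟩
  have hfixP : ∀ t, 0 < t → ∀ y, S t (P y) = P y := fun t ht y => by
    obtain ⟨c, hc⟩ := hspan y
    rw [hc, map_smul, hSe t ht]
  -- Any functional with `ψ e ≠ 0` reads off the coefficient: `P y = c • e` gives `c = ψ (P y) / ψ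
  -- e`.
  obtain ⟨ψ, -, hψ⟩ := exists_dual_vector ℝ e (norm_ne_zero_iff.2 he.ne')
  have hψe : ψ e ≠ 0 := by rw [hψ]; simpa using he.ne'
  have hP_eq : P = ((ψ e)⁻¹ • ψ.comp P).smulRight e := by
    ext y
    obtain ⟨c, hc⟩ := hspan y
    have h : (ψ e)⁻¹ * (c * ψ e) = c := by field_simp
    simp [hc, h]
  refine ⟨e, (ψ e)⁻¹ • ψ.comp P, hq, fun f hf => ?_, ?_⟩
  · have h1 : P f = ((ψ e)⁻¹ • ψ.comp P) f • e := congrArg (fun A : E →L[ℝ] E => A f) hP_eq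
    by_contra! hle
    have h2 : P f = 0 := le_antisymm
      (h1.trans_le (smul_nonpos_of_nonpos_of_nonneg hle he.le)) (hP.nonneg hpos hf.le)
    exact hf.ne' (hstrict f hf.le h2)
  · rw [← hP_eq]
    exact PosSemigroup.tendsto_of_tendsto_apply hS ha hess hM
      (fun t ht y => by rw [hP.comm hS ht, hfixP t ht])
      (hP.tendsto_apply hS hM hfixP)
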